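/- Let $d\ge 1$, $\alpha\in(0,2)$, $\gamma>1$. For a measurable coefficient $\Lambda:\mathbb R^d\times\mathbb R^d\to[c,C]$, $0<c\le C<\infty$, and a measurable weight $\nu:\mathbb R^d\to[c,C]$ such that $\Lambda(x,y)\nu(x)$ is symmetric in $(x,y)$, the Lévy-type operator $$Lu(x)=\int_{\mathbb R^d}\frac{u(y)-u(x)}{|x-y|^{d+\alpha}}\,\Lambda(x,y)\,dy$$ is understood as the operator in $L^2(\mathbb R^d,\nu)$ associated with its quadratic form on $H^{\alpha/2}(\mathbb R^d)$: $u\in D(L)$ and $Lu=g\in L^2(\mathbb R^d)$ if and only if $u\in H^{\alpha/2}(\mathbb R^d)$ and for all $v\in H^{\alpha/2}(\mathbb R^d)$ $$-\frac12\int_{\mathbb R^d}\int_{\mathbb R^d}\Lambda(x,y)\frac{(u(y)-u(x))(v(y)-v(x))}{|x-y|^{d+\alpha}}\,\nu(x)\,dx\,dy=\int_{\mathbb R^d} g\,v\,\nu\,dx .$$ Here all functions are real valued and $H^{\alpha/2}(\mathbb R^d)$ carries the norm $\|u\|^2=\int u^2+\iint \frac{(u(x)-u(y))^2}{|x-y|^{d+\alpha}}\,dx\,dy$.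 Assume that one of the following two conditions holds for the coefficients $\Lambda^\varepsilon$, $\varepsilon>0$. (P1) $\Lambda^\varepsilon(x,y)=\lambda(x/\varepsilon)\,\mu(y/\varepsilon)$, where $\lambda,\mu$ are measurable, $1$-periodic in each coordinate direction, and $\gamma^{-1}\le\lambda,\mu\le\gamma$. In this case let $\nu^\varepsilon(x)=\mu(x/\varepsilon)/\lambda(x/\varepsilon)$ and $$\Lambda^{\rm eff}(x,y)=\Big(\int_{[0,1]^d}\frac{\mu(\xi)}{\lambda(\xi)}\,d\xi\Big)^{-1}\Big(\int_{[0,1]^d}\mu(\xi)\,d\xi\Big)^2 .$$ (P2) $\Lambda^\varepsilon(x,y)=\Lambda(x,y,x/\varepsilon,y/\varepsilon)$, where $\Lambda(x,y,\xi,\eta)$ is continuous in $(x,y)$, measurable in $(\xi,\eta)$ and $1$-periodic in each coordinate of $\xi$ and $\eta$, with $\Lambda(x,y,\xi,\eta)=\Lambda(y,x,\eta,\xi)$ and $\gamma^{-1}\le\Lambda\le\gamma$ everywhere. In this case let $\nu^\varepsilon=1$ and $$\Lambda^{\rm eff}(x,y)=\int_{[0,1]^d}\int_{[0,1]^d}\Lambda(x,y,\xi,\eta)\,d\xi\,d\eta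 .$$ Let $L^\varepsilon$ be the operator with coefficient $\Lambda^\varepsilon$ and weight $\nu^\varepsilon$, and $L^0$ the operator with coefficient $\Lambda^{\rm eff}$ and weight $1$. Then for every $m>0$ and every $f\in L^2(\mathbb R^d)$ the equations $(L^\varepsilon-m)u^\varepsilon=f$ (for each $\varepsilon>0$) and $(L^0-m)u^0=f$ have unique solutions, and as $\varepsilon\to0^+$ the solutions $u^\varepsilon$ converge to $u^0$ strongly in $L^2(\mathbb R^d)$ and weakly in $H^{\alpha/2}(\mathbb R^d)$. -/

import Mathlib

open MeasureTheory Filter Topology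

noncomputable section

namespace LevyHomogenization

/-- The space `ℝ^d` with its Euclidean norm and Lebesgue measure. -/
abbrev Euc (d : ℕ) : Type := EuclideanSpace ℝ (Fin d)

/-- The real Hilbert space `L²(ℝ^d)`. -/
abbrev L2 (d : ℕ) : Type := Lp ℝ 2 (volume : Measure (Euc d))

/-- The real Hilbert space `L²(ℝ^d × ℝ^d)`. -/
abbrev L2Pair (d : ℕ) : Type := Lp ℝ 2 (volume : Measure (Euc d × Euc d))

/-- The fractional difference quotient `(u(y) - u(x)) / |x - y|^{d/2 + s}`. -/
def fracDiff {d : ℕ} (s : ℝ) (u : Euc d → ℝ) (p : Euc d × Euc d) : ℝ :=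
  (u p.2 - u p.1) / ‖p.1 - p.2‖ ^ ((d : ℝ) / 2 + s)

theorem fracDiff_ae_congr {d : ℕ} (s : ℝ) {u v : Euc d → ℝ} (h : u =ᵐ[volume] v) :
    fracDiff s u =ᵐ[(volume : Measure (Euc d × Euc d))] fracDiff s v := by
  have h1 := (Measure.quasiMeasurePreserving_fst
    (μ := (volume : Measure (Euc d))) (ν := (volume : Measure (Euc d)))).ae_eq_comp h
  have h2 := (Measure.quasiMeasurePreserving_snd
    (μ := (volume : Measure (Euc d))) (ν := (volume : Measure (Euc d)))).ae_eq_comp h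
  rw [← Measure.volume_eq_prod] at h1 h2
  filter_upwards [h1, h2] with p hp1 hp2
  simp only [Function.comp_apply] at hp1 hp2
  simp only [fracDiff, hp1, hp2]

/-- The fractional Sobolev space `H^s(ℝ^d) = W^{s,2}(ℝ^d)` in its Gagliardo form. A function
`u ∈ L²(ℝ^d)` whose fractional difference quotient `D u` is square integrable on `ℝ^d × ℝ^d` is
represented by the pair `(u, D u)`, so that the Hilbert norm inherited from
`L²(ℝ^d) × L²(ℝ^d × ℝ^d)` is the usual one,
`‖u‖² = ∫ u² + ∫∫ (u(x) - u(y))² / |x - y|^{d + 2s}`; see `exists_mem_fracSobolev_iff` and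
`norm_sq_fracSobolev`. -/
def fracSobolev (d : ℕ) (s : ℝ) : Submodule ℝ (WithLp 2 (L2 d × L2Pair d)) where
  carrier := {w | (w.snd : Euc d × Euc d → ℝ) =ᵐ[volume] fracDiff s (w.fst : Euc d → ℝ)}
  zero_mem' := by
    have h := fracDiff_ae_congr s (Lp.coeFn_zero ℝ 2 (volume : Measure (Euc d)))
    refine (Lp.coeFn_zero ℝ 2 (volume : Measure (Euc d × Euc d))).trans ?_
    refine EventuallyEq.trans ?_ h.symm
    exact Eventually.of_forall fun p => by simp [fracDiff]
  add_mem' := by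
    intro a b ha hb
    have h := fracDiff_ae_congr s (Lp.coeFn_add a.fst b.fst)
    have h' := Lp.coeFn_add a.snd b.snd
    simp only [Set.mem_ofPred_eq] at ha hb ⊢
    refine h'.trans (EventuallyEq.trans ?_ h.symm)
    filter_upwards [ha, hb] with p hpa hpb
    simp only [Pi.add_apply, hpa, hpb, fracDiff]
    ring
  smul_mem' := by
    intro c a ha
    have h := fracDiff_ae_congr s (Lp.coeFn_smul c a.fst)
    have h' := Lp.coeFn_smul c a.snd
    simp only [Set.mem_ofPred_eq] at ha ⊢
    refine h'.trans (EventuallyEq.trans ?_ h.symm)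
    filter_upwards [ha] with p hpa
    simp only [Pi.smul_apply, hpa, fracDiff, smul_eq_mul]
    ring

/-- The inclusion `H^s(ℝ^d) ⊂ L²(ℝ^d)`. -/
def toL2 {d : ℕ} {s : ℝ} (u : fracSobolev d s) : L2 d := (u : WithLp 2 (L2 d × L2Pair d)).fst

/-- `toL2` is injective: an element of `H^s` is determined by its class in `L²`. -/
theorem toL2_injective {d : ℕ} {s : ℝ} :
    Function.Injective (toL2 : fracSobolev d s → L2 d) := by
  rintro ⟨u, hu⟩ ⟨v, hv⟩ h
  change u.fst = v.fst at h
  have h2 : u.snd = v.snd := by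
    refine Lp.ext ?_
    have hu' : (u.snd : Euc d × Euc d → ℝ) =ᵐ[volume] fracDiff s (u.fst : Euc d → ℝ) := hu
    have hv' : (v.snd : Euc d × Euc d → ℝ) =ᵐ[volume] fracDiff s (v.fst : Euc d → ℝ) := hv
    rw [h] at hu'
    exact hu'.trans hv'.symm
  refine Subtype.ext ?_
  exact (WithLp.equiv 2 _).injective (Prod.ext h h2)

/-- `u ∈ L²` belongs to `H^s` exactly when its difference quotient is square integrable. -/
theorem exists_mem_fracSobolev_iff {d : ℕ} {s : ℝ} (u : L2 d) :
    (∃ w : fracSobolev d s, toL2 w = u) ↔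
      MemLp (fracDiff s (u : Euc d → ℝ)) 2 (volume : Measure (Euc d × Euc d)) := by
  constructor
  · rintro ⟨⟨w, hw⟩, rfl⟩
    have hw' : (w.snd : Euc d × Euc d → ℝ) =ᵐ[volume] fracDiff s (w.fst : Euc d → ℝ) := hw
    exact (memLp_congr_ae hw').1 (Lp.memLp w.snd)
  · intro h
    exact ⟨⟨WithLp.toLp 2 (u, h.toLp _), h.coeFn_toLp⟩, rfl⟩

/-- The norm of `H^s` is the Gagliardo norm. -/
theorem norm_sq_fracSobolev {d : ℕ} {s : ℝ} (u : fracSobolev d s) :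
    ‖u‖ ^ 2 = (∫ x, toL2 u x ^ 2) +
      ∫ p : Euc d × Euc d, (toL2 u p.2 - toL2 u p.1) ^ 2 / ‖p.1 - p.2‖ ^ ((d : ℝ) + 2 * s) := by
  obtain ⟨w, hw⟩ := u
  have hw' : (w.snd : Euc d × Euc d → ℝ) =ᵐ[volume] fracDiff s (w.fst : Euc d → ℝ) := hw
  have e1 : ‖w.fst‖ ^ 2 = ∫ x, w.fst x ^ 2 := by
    rw [← real_inner_self_eq_norm_sq, L2.inner_def]
    simp [pow_two]
  have e2 : ‖w.snd‖ ^ 2 = ∫ p, w.snd p ^ 2 := by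
    rw [← real_inner_self_eq_norm_sq, L2.inner_def]
    simp [pow_two]
  have e3 : (∫ p, w.snd p ^ 2) = ∫ p : Euc d × Euc d,
      (w.fst p.2 - w.fst p.1) ^ 2 / ‖p.1 - p.2‖ ^ ((d : ℝ) + 2 * s) := by
    refine integral_congr_ae ?_
    filter_upwards [hw'] with p hp
    rw [hp, fracDiff, div_pow, ← Real.rpow_mul_natCast (norm_nonneg _)]
    congr 2
    push_cast
    ring
  change ‖w‖ ^ 2 = _
  rw [WithLp.prod_norm_sq_eq_of_L2, e1, e2, e3]
  rfl

/-- The symmetric bilinear form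
`½ ∫∫ Λ(x,y) (u(y) - u(x)) (v(y) - v(x)) |x - y|^{-d-α} ν(x) dx dy`, which is the form
`(-L u, v)` in the weighted space `L²(ℝ^d, ν)` for
`L u(x) = ∫ Λ(x,y) (u(y) - u(x)) |x - y|^{-d-α} dy` whenever `Λ(x,y) ν(x)` is symmetric. -/
def levyForm {d : ℕ} (α : ℝ) (Λ : Euc d → Euc d → ℝ) (ν : Euc d → ℝ) (u v : Euc d → ℝ) : ℝ :=
  (1 / 2) * ∫ p : Euc d × Euc d,
    Λ p.1 p.2 * ((u p.2 - u p.1) * (v p.2 - v p.1)) / ‖p.1 - p.2‖ ^ ((d : ℝ) + α) * ν p.1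

/-- The graph of the Lévy-type operator `L` with kernel `Λ(x,y) |x - y|^{-d-α}`, realized as the
operator of the form `levyForm` (with form domain `H^{α/2}`) in the weighted space `L²(ℝ^d, ν)`:
`u ∈ D(L)` and `L u = g` if and only if `-form(u, v) = (g, v)_{L²(ν)}` for all `v ∈ H^{α/2}`. -/
def LevyOperatorGraph {d : ℕ} (α : ℝ) (Λ : Euc d → Euc d → ℝ) (ν : Euc d → ℝ)
    (u : fracSobolev d (α / 2)) (g : L2 d) : Prop :=
  ∀ v : fracSobolev d (α / 2), -levyForm α Λ ν (toL2 u) (toL2 v) = ∫ x, g x * toL2 v x * ν x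

/-- `u` solves `(L - m) u = f`: `u` lies in the domain of `L`, and `L u - m u = f` in `L²`. -/
def IsResolventSolution {d : ℕ} (α : ℝ) (Λ : Euc d → Euc d → ℝ) (ν : Euc d → ℝ) (m : ℝ)
    (f : L2 d) (u : fracSobolev d (α / 2)) : Prop :=
  ∃ g : L2 d, LevyOperatorGraph α Λ ν u g ∧ g - m • toL2 u = f

/-- `1`-periodicity in each coordinate direction. -/
def UnitPeriodic {d : ℕ} (h : Euc d → ℝ) : Prop :=
  ∀ (i : Fin d) (ξ : Euc d), h (ξ + EuclideanSpace.single i 1) = h ξ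

/-- The cell `[0,1]^d`. -/
def unitCell (d : ℕ) : Set (Euc d) := {ξ | ∀ i, ξ i ∈ Set.Icc (0 : ℝ) 1}

/-- Product structure. The coefficient is `Λ^ε(x,y) = λ(x/ε) μ(y/ε)`, the symmetrizing weight is
`ν^ε(x) = μ(x/ε) / λ(x/ε)`, and the effective coefficient is the constant
`(∫ μ/λ)⁻¹ (∫ μ)²`, with integrals over the cell. -/
def ProductCase {d : ℕ} (γ : ℝ) (Λε : ℝ → Euc d → Euc d → ℝ) (νε : ℝ → Euc d → ℝ)
    (Λeff : Euc d → Euc d → ℝ) : Prop :=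
  ∃ lam mu : Euc d → ℝ,
    AEMeasurable lam ∧ AEMeasurable mu ∧ UnitPeriodic lam ∧ UnitPeriodic mu ∧
    (∀ ξ, γ⁻¹ ≤ lam ξ ∧ lam ξ ≤ γ) ∧ (∀ η, γ⁻¹ ≤ mu η ∧ mu η ≤ γ) ∧
    (∀ ε x y, Λε ε x y = lam (ε⁻¹ • x) * mu (ε⁻¹ • y)) ∧
    (∀ ε x, νε ε x = mu (ε⁻¹ • x) / lam (ε⁻¹ • x)) ∧
    ∀ x y, Λeff x y =
      (∫ ξ in unitCell d, mu ξ / lam ξ)⁻¹ * (∫ ξ in unitCell d, mu ξ) ^ 2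

/-- Symmetric locally periodic structure. The coefficient is `Λ^ε(x,y) = Λ(x,y,x/ε,y/ε)`, the
weight is `1`, and the effective coefficient is the average of `Λ(x,y,·,·)` over two cells. -/
def LocallyPeriodicCase {d : ℕ} (γ : ℝ) (Λε : ℝ → Euc d → Euc d → ℝ) (νε : ℝ → Euc d → ℝ)
    (Λeff : Euc d → Euc d → ℝ) : Prop :=
  ∃ Λ : Euc d → Euc d → Euc d → Euc d → ℝ,
    (∀ ξ η, Continuous fun p : Euc d × Euc d => Λ p.1 p.2 ξ η) ∧
    (∀ x y, AEMeasurable fun q : Euc d × Euc d => Λ x y q.1 q.2) ∧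
    (∀ x y η, UnitPeriodic fun ξ => Λ x y ξ η) ∧
    (∀ x y ξ, UnitPeriodic fun η => Λ x y ξ η) ∧
    (∀ x y ξ η, Λ x y ξ η = Λ y x η ξ) ∧
    (∀ x y ξ η, γ⁻¹ ≤ Λ x y ξ η ∧ Λ x y ξ η ≤ γ) ∧
    (∀ ε x y, Λε ε x y = Λ x y (ε⁻¹ • x) (ε⁻¹ • y)) ∧
    (∀ ε x, νε ε x = 1) ∧
    ∀ x y, Λeff x y = ∫ η in unitCell d, ∫ ξ in unitCell d, Λ x y ξ η

end LevyHomogenization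

end

open LevyHomogenization

open MeasureTheory Filter Topology

noncomputable section

/-! In weak form the equation reads `½∫∫ κ^ε Du Dv + m∫ ν^ε u v = -∫ ν^ε f v`, with `Du` the
fractional difference quotient and `κ^ε = Λ^ε(x,y) ν^ε(x)`. In the product case `κ^ε = μ(x/ε)
μ(y/ε)`. In both cases `κ^ε` and `ν^ε` are bounded above and below and converge weakly-* in `L^∞` to
their cell averages `κ₀` and `ν₀`; dividing the limit equation by the constant `ν₀` produces `Λeff`
and the weight `1`.

No corrector is needed, and this is where the nonlocal problem differs from a second-order one: `D`
is a difference quotient, so away from the diagonal `Dv` is controlled by `v` in `L²` alone. For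
fixed `u₀` the part of `Du₀` near the diagonal or near infinity has small `L²` norm. On the
remaining separated, bounded pairs, `v ↦ ∫∫ (κ^ε - κ₀) Du₀ Dv` is a functional on `L²` of a ball,
bounded uniformly in `ε` and tending to zero for each `v`. Local compactness of `H^s` in `L²` makes
this uniform over the unit ball of `H^s` (`eventually_abs_le_mul_norm`); the compactness is used
quantitatively, through a fractional Poincaré inequality on a fine grid. The zero-order terms are
treated in the same way.

Subtracting the two equations and testing with `z = u^ε - u₀`, coercivity gives `‖z‖² ≤ o(1)‖z‖`
(`tendsto_weakSolution`). Hence the convergence is even strong in `H^{α/2}`, and both claims follow.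
Existence and uniqueness are Lax–Milgram.

The weak-* limit (`tendsto_integral_locally_periodic`) comes from averaging over shifts by `ετ` with
`τ` in the cell: the shifts replace the fast variable by its mean, and they barely change the
integrand, since translation is continuous in `L¹` and the coefficient is continuous in the slow
variable. -/

namespace LevyHomogenization

/-! ### Weak-* limits of oscillating coefficients -/

section WeakStar

variable {Z : Type*} [NormedAddCommGroup Z] [NormedSpace ℝ Z] [FiniteDimensional ℝ Z]
  [MeasurableSpace Z] [BorelSpace Z] {μ : Measure Z} [μ.IsAddHaarMeasure]

/-- Translation is continuous in `L¹`. -/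
theorem tendsto_integral_abs_translate_sub {G : Z → ℝ} (hG : Integrable G μ) :
    Tendsto (fun t : Z => ∫ z, |G (z - t) - G z| ∂μ) (𝓝 0) (𝓝 0) := by
  rw [Metric.tendsto_nhds]
  intro e he
  obtain ⟨g, hgs, hgG, hgc, hgi⟩ :=
    hG.exists_hasCompactSupport_integral_sub_le (ε := e / 4) (by positivity)
  have key : Tendsto (fun t : Z => ∫ z, |g (z - t) - g z| ∂μ) (𝓝 0) (𝓝 0) := by
    have hU : UniformContinuous g := hgs.uniformContinuous_of_continuous hgc
    obtain ⟨R, hR⟩ := hgs.isCompact.isBounded.subset_closedBall (0 : Z)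
    rw [Metric.tendsto_nhds]
    intro η hη
    -- Radius `R + 1` contains the support of `g` and of all its translates by vectors shorter than
    -- `1`.
    set V := μ.real (Metric.closedBall (0 : Z) (R + 1)) with hV
    have hV0 : 0 ≤ V := measureReal_nonneg
    obtain ⟨ρ, hρ, hρg⟩ := Metric.uniformContinuous_iff.1 hU (η / (V + 1)) (by positivity)
    filter_upwards [Metric.ball_mem_nhds (0 : Z) (lt_min hρ one_pos)] with t ht
    rw [mem_ball_zero_iff, lt_min_iff] at ht
    have hz : ∀ z ∉ Metric.closedBall (0 : Z) (R + 1), |g (z - t) - g z| = 0 := by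
      intro z hz
      rw [mem_closedBall_zero_iff, not_le] at hz
      have h1 : g z = 0 := by
        by_contra h
        have := hR (subset_tsupport _ h)
        rw [mem_closedBall_zero_iff] at this
        linarith
      have h2 : g (z - t) = 0 := by
        by_contra h
        have h3 := hR (subset_tsupport _ h)
        rw [mem_closedBall_zero_iff] at h3
        have := norm_sub_norm_le z t
        linarith
      simp [h1, h2]
    rw [← setIntegral_eq_integral_of_forall_compl_eq_zero hz, dist_zero_right]
    have := norm_setIntegral_le_of_norm_le_const (μ := μ)
      (f := fun z => |g (z - t) - g z|) (s := Metric.closedBall (0 : Z) (R + 1))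
      (C := η / (V + 1)) (isCompact_closedBall _ _).measure_lt_top (by
        intro z _
        have h4 := hρg (a := z - t) (b := z) (by simpa [dist_eq_norm] using ht.1)
        rw [Real.dist_eq] at h4
        simpa using h4.le)
    refine this.trans_lt ?_
    rw [← hV, div_mul_eq_mul_div, div_lt_iff₀ (by positivity)]
    nlinarith
  filter_upwards [(Metric.tendsto_nhds.1 key) (e / 4) (by positivity)] with t ht
  have hGt : Integrable (fun z => G (z - t)) μ := hG.comp_sub_right t
  have hgt : Integrable (fun z => g (z - t)) μ := hgi.comp_sub_right t
  have i1 : ∫ z, |G (z - t) - g (z - t)| ∂μ = ∫ z, |G z - g z| ∂μ :=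
    integral_sub_right_eq_self (fun z => |G z - g z|) t
  have hgG' : ∫ z, |G z - g z| ∂μ ≤ e / 4 := hgG
  have hle : ∫ z, |G (z - t) - G z| ∂μ ≤
      ∫ z, (|G (z - t) - g (z - t)| + |g (z - t) - g z| + |G z - g z|) ∂μ := by
    refine integral_mono (hGt.sub hG).abs
      (((hGt.sub hgt).abs.add (hgt.sub hgi).abs).add (hG.sub hgi).abs) fun z => ?_
    calc |G (z - t) - G z|
        = |(G (z - t) - g (z - t)) + (g (z - t) - g z) + (g z - G z)| := by ring_nf
      _ ≤ _ := by
        rw [abs_sub_comm (G z) (g z)]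
        exact abs_add_three _ _ _
  have j1 : Integrable (fun z => |G (z - t) - g (z - t)|) μ := (hGt.sub hgt).abs
  have j2 : Integrable (fun z => |g (z - t) - g z|) μ := (hgt.sub hgi).abs
  have j3 : Integrable (fun z => |G z - g z|) μ := (hG.sub hgi).abs
  have j12 : Integrable (fun z => |G (z - t) - g (z - t)| + |g (z - t) - g z|) μ := j1.add j2
  rw [integral_add j12 j3, integral_add j1 j2, i1] at hle
  rw [Real.dist_eq, sub_zero] at ht ⊢
  have h0 : 0 ≤ ∫ z, |G (z - t) - G z| ∂μ := integral_nonneg fun z => abs_nonneg _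
  rw [abs_of_nonneg h0]
  have := (abs_lt.1 ht).2
  linarith

set_option linter.unusedSectionVars false in
/-- A function which is continuous in `p` and a.e. measurable in `q` agrees, for all `p` and almost
every `q`, with a jointly measurable function. -/
theorem exists_measurable_uncurry {k : Z → Z → ℝ} (hc : ∀ q, Continuous fun p => k p q)
    (hm : ∀ p, AEMeasurable (k p) μ) {M : ℝ} (hb : ∀ p q, |k p q| ≤ M) :
    ∃ k' : Z → Z → ℝ, Measurable (Function.uncurry k') ∧ (∀ p q, |k' p q| ≤ M) ∧
      ∀ᵐ q ∂μ, ∀ p, k' p q = k p q := by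
  obtain ⟨s, hs, hsd⟩ := TopologicalSpace.exists_countable_dense Z
  have hM : 0 ≤ M := (abs_nonneg _).trans (hb 0 0)
  -- Countability of `s` gives one null set of `q` valid for every `p`, by continuity also off `s`.
  -- Uniformity in `p` is essential: along `q = p/ε` the slow argument moves with the fast one.
  have hae : ∀ᵐ q ∂μ, ∀ p ∈ s, k p q = (hm p).mk (k p) q :=
    (ae_ball_iff hs).2 fun p _ => (hm p).ae_eq_mk
  obtain ⟨t, htsub, htm, ht0⟩ := exists_measurable_superset_of_null (ae_iff.1 hae)
  have hgood : ∀ q ∉ t, ∀ p ∈ s, k p q = (hm p).mk (k p) q := by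
    intro q hq
    by_contra h
    exact hq (htsub h)
  refine ⟨fun p => tᶜ.indicator (k p), ?_, ?_, ?_⟩
  · refine measurable_uncurry_of_continuous_of_measurable (fun q => ?_) (fun p => ?_)
    · by_cases hq : q ∈ t
      · simpa [hq] using continuous_const
      · simpa [hq] using hc q
    · obtain ⟨a, has, hap⟩ := mem_closure_iff_seq_limit.1 (hsd p)
      refine measurable_of_tendsto_metrizable
        (f := fun n => tᶜ.indicator ((hm (a n)).mk (k (a n))))
        (fun n => (hm (a n)).measurable_mk.indicator htm.compl) ?_
      rw [tendsto_pi_nhds]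
      intro q
      by_cases hq : q ∈ t
      · simp [hq]
      · simp only [Set.mem_compl_iff, hq, not_false_eq_true, Set.indicator_of_mem]
        simp_rw [← hgood q hq _ (has _)]
        exact ((hc q).tendsto p).comp hap
  · intro p q
    by_cases hq : q ∈ t
    · simpa [hq] using hM
    · simpa [hq] using hb p q
  · have : ∀ᵐ q ∂μ, q ∉ t := by simpa [ae_iff] using ht0
    filter_upwards [this] with q hq p
    simp [hq]

theorem ae_comp_inv_smul {P : Z → Prop} (h : ∀ᵐ q ∂μ, P q) {ε : ℝ} (hε : 0 < ε) :
    ∀ᵐ p ∂μ, P (ε⁻¹ • p) :=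
  (Measure.quasiMeasurePreserving_smul μ (inv_ne_zero hε.ne')).ae h

theorem ae_comp_add {P : Z → Prop} (h : ∀ᵐ q ∂μ, P q) (z : Z) : ∀ᵐ p ∂μ, P (z + p) :=
  (quasiMeasurePreserving_add_left μ z).ae h

/-- The rescaled coefficient `p ↦ k(p, p/ε)` is a.e. measurable. -/
theorem aemeasurable_rescaled {k : Z → Z → ℝ} (hc : ∀ q, Continuous fun p => k p q)
    (hm : ∀ p, AEMeasurable (k p) μ) {M : ℝ} (hb : ∀ p q, |k p q| ≤ M) {ε : ℝ} (hε : 0 < ε) :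
    AEMeasurable (fun p => k p (ε⁻¹ • p)) μ := by
  obtain ⟨k', hk', -, hkk⟩ := exists_measurable_uncurry hc hm hb
  refine ⟨fun p => k' p (ε⁻¹ • p), ?_, ?_⟩
  · exact hk'.comp (measurable_id.prodMk (measurable_const_smul _))
  · filter_upwards [ae_comp_inv_smul hkk hε] with p hp
    exact (hp p).symm

/-- The averaged coefficient is a.e. measurable. -/
theorem aemeasurable_average {k : Z → Z → ℝ} (hc : ∀ q, Continuous fun p => k p q)
    (hm : ∀ p, AEMeasurable (k p) μ) {M : ℝ} (hb : ∀ p q, |k p q| ≤ M) (Y : Set Z) :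
    AEMeasurable (fun p => ∫ q in Y, k p q ∂μ) μ := by
  obtain ⟨k', hk', -, hkk⟩ := exists_measurable_uncurry hc hm hb
  have : (fun p => ∫ q in Y, k p q ∂μ) = fun p => ∫ q in Y, k' p q ∂μ := by
    funext p
    refine integral_congr_ae (ae_restrict_of_ae ?_)
    filter_upwards [hkk] with q hq
    exact (hq p).symm
  rw [this]
  exact (StronglyMeasurable.integral_prod_right hk'.stronglyMeasurable).measurable.aemeasurable

variable {Y : Set Z}

/-- Comparison of an oscillating integral with its average over translates: if translating by
`ετ`, `τ ∈ Y`, changes the integrand by at most `η` in `L¹`, then the oscillating integral is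
`η`-close to the averaged one. -/
theorem abs_integral_rescaled_sub_le (hY1 : μ Y = 1) {k : Z → Z → ℝ}
    (hk : Measurable (Function.uncurry k)) {M : ℝ} (hb : ∀ p q, |k p q| ≤ M)
    {c : Z → ℝ} {ε : ℝ} (hε : 0 < ε) (hcY : ∀ p, ∫ τ in Y, k p (ε⁻¹ • p + τ) ∂μ = c p)
    {G : Z → ℝ} (hG : Integrable G μ) {η : ℝ}
    (hη : ∀ τ ∈ Y, ∫ p, |G p * k p (ε⁻¹ • p) -
      G (p - ε • τ) * k (p - ε • τ) (ε⁻¹ • p)| ∂μ ≤ η) :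
    |∫ p, k p (ε⁻¹ • p) * G p ∂μ - ∫ p, c p * G p ∂μ| ≤ η := by
  have hYfin : IsFiniteMeasure (μ.restrict Y) := ⟨by simp [hY1]⟩
  have hm1 : ∀ {f g : Z × Z → Z}, Measurable f → Measurable g →
      Measurable fun x => k (f x) (g x) := fun hf hg => hk.comp (hf.prodMk hg)
  have hm2 : ∀ {f g : Z → Z}, Measurable f → Measurable g →
      Measurable fun x => k (f x) (g x) := fun hf hg => hk.comp (hf.prodMk hg)
  have hint : Integrable (fun x : Z × Z => G x.1 * k x.1 (ε⁻¹ • x.1 + x.2))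
      (μ.prod (μ.restrict Y)) := by
    refine Integrable.mul_bdd (c := M) (hG.comp_fst _) ?_ (Eventually.of_forall fun x => hb _ _)
    exact (hm1 measurable_fst (by fun_prop)).aestronglyMeasurable
  -- Writing `c` as a mean over `τ`, Fubini moves `τ` outside; the substitution `p ↦ p - ετ` then
  -- turns the fast argument `p/ε + τ` back into `p/ε` and shifts only the slow ones.
  have e1 : ∫ p, c p * G p ∂μ = ∫ τ in Y, ∫ p, G (p - ε • τ) * k (p - ε • τ) (ε⁻¹ • p) ∂μ ∂μ := by
    calc ∫ p, c p * G p ∂μ = ∫ p, ∫ τ in Y, G p * k p (ε⁻¹ • p + τ) ∂μ ∂μ := by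
          refine integral_congr_ae (Eventually.of_forall fun p => ?_)
          simp only [integral_const_mul, hcY, mul_comm]
      _ = ∫ τ in Y, ∫ p, G p * k p (ε⁻¹ • p + τ) ∂μ ∂μ := integral_integral_swap hint
      _ = _ := by
          refine integral_congr_ae (Eventually.of_forall fun τ => ?_)
          simp only
          rw [← integral_sub_right_eq_self (fun p => G p * k p (ε⁻¹ • p + τ)) (ε • τ)]
          refine integral_congr_ae (Eventually.of_forall fun p => ?_)
          simp only
          congr 2
          rw [smul_sub, smul_smul, inv_mul_cancel₀ hε.ne', one_smul, sub_add_cancel]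
  have hint1 : Integrable (fun p => G p * k p (ε⁻¹ • p)) μ :=
    Integrable.mul_bdd (c := M) hG (hm2 measurable_id (by fun_prop)).aestronglyMeasurable
      (Eventually.of_forall fun x => hb _ _)
  have hint2 : ∀ τ, Integrable (fun p => G (p - ε • τ) * k (p - ε • τ) (ε⁻¹ • p)) μ := fun τ =>
    Integrable.mul_bdd (c := M) (hG.comp_sub_right _)
      (hm2 (by fun_prop) (by fun_prop)).aestronglyMeasurable
      (Eventually.of_forall fun x => hb _ _)
  have hint3 : Integrable
      (fun τ => ∫ p, G (p - ε • τ) * k (p - ε • τ) (ε⁻¹ • p) ∂μ) (μ.restrict Y) := by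
    have := hint.integral_prod_right
    refine this.congr (Eventually.of_forall fun τ => ?_)
    simp only
    rw [← integral_sub_right_eq_self (fun p => G p * k p (ε⁻¹ • p + τ)) (ε • τ)]
    refine integral_congr_ae (Eventually.of_forall fun p => ?_)
    simp only
    congr 2
    rw [smul_sub, smul_smul, inv_mul_cancel₀ hε.ne', one_smul, sub_add_cancel]
  have e2 : ∫ p, k p (ε⁻¹ • p) * G p ∂μ =
      ∫ τ in Y, (∫ p, G p * k p (ε⁻¹ • p) ∂μ) ∂μ := by
    simp [measureReal_def, hY1, mul_comm]
  rw [e1, e2, ← integral_sub (integrable_const _) hint3]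
  have := norm_setIntegral_le_of_norm_le_const (μ := μ) (s := Y) (C := η)
    (f := fun τ => (∫ p, G p * k p (ε⁻¹ • p) ∂μ) -
      ∫ p, G (p - ε • τ) * k (p - ε • τ) (ε⁻¹ • p) ∂μ) (by simp [hY1]) (by
      intro τ hτ
      rw [← integral_sub hint1 (hint2 τ)]
      exact (norm_integral_le_integral_norm _).trans (hη τ hτ))
  simpa [measureReal_def, hY1] using this

/-- `Y` is an averaging cell for the set of periods `Γ`: it is bounded, has unit mass, and every
`Γ`-periodic function has the same average over all translates of `Y`. -/
structure IsAveragingCell (μ : Measure Z) (Γ Y : Set Z) : Prop where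
  bounded : Bornology.IsBounded Y
  mass : μ Y = 1
  average : ∀ h : Z → ℝ, (∀ g ∈ Γ, ∀ z, h (z + g) = h z) →
    ∀ z, ∫ τ in Y, h (z + τ) ∂μ = ∫ τ in Y, h τ ∂μ

variable {Γ : Set Z}

/-- Oscillating periodic functions converge weakly-* to their mean. -/
theorem tendsto_integral_periodic (hY : IsAveragingCell μ Γ Y) {h : Z → ℝ}
    (hm : AEMeasurable h μ) {M : ℝ} (hb : ∀ q, |h q| ≤ M)
    (hp : ∀ g ∈ Γ, ∀ z, h (z + g) = h z) {G : Z → ℝ} (hG : Integrable G μ) :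
    Tendsto (fun ε : ℝ => ∫ p, h (ε⁻¹ • p) * G p ∂μ) (𝓝[>] 0)
      (𝓝 (∫ p, (∫ τ in Y, h τ ∂μ) * G p ∂μ)) := by
  obtain ⟨k', hk', hb', hkk⟩ := exists_measurable_uncurry (μ := μ) (k := fun _ => h)
    (fun q => continuous_const) (fun _ => hm) (fun _ => hb)
  have hM : 0 ≤ M := (abs_nonneg _).trans (hb 0)
  obtain ⟨C, hC⟩ := hY.bounded.exists_norm_le
  rw [Metric.tendsto_nhds]
  intro e he
  obtain ⟨ρ, hρ, hρG⟩ := Metric.eventually_nhds_iff.1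
    (Metric.tendsto_nhds.1 (tendsto_integral_abs_translate_sub hG) (e / (2 * (M + 1)))
      (by positivity))
  have hlim : Tendsto (fun ε : ℝ => ε * C) (𝓝[>] 0) (𝓝 0) := by
    have : Tendsto (fun ε : ℝ => ε * C) (𝓝 0) (𝓝 (0 * C)) :=
      tendsto_id.mul_const C
    rw [zero_mul] at this
    exact this.mono_left nhdsWithin_le_nhds
  filter_upwards [self_mem_nhdsWithin, hlim.eventually (gt_mem_nhds hρ)] with ε hε hεC
  have hε : 0 < ε := hε
  have h1 : ∫ p, h (ε⁻¹ • p) * G p ∂μ = ∫ p, k' 0 (ε⁻¹ • p) * G p ∂μ := by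
    refine integral_congr_ae ?_
    filter_upwards [ae_comp_inv_smul hkk hε] with p hp
    simp only [hp]
  rw [Real.dist_eq, h1]
  refine lt_of_le_of_lt (abs_integral_rescaled_sub_le (η := e / 2) hY.mass
    (k := fun _ => k' 0) ?_ (fun _ => hb' 0) hε (c := fun _ => ∫ τ in Y, h τ ∂μ) ?_ hG ?_)
    (by linarith)
  · exact (hk'.comp (measurable_const.prodMk measurable_snd) : Measurable fun x : Z × Z =>
      Function.uncurry k' (0, x.2))
  · intro p
    rw [← hY.average h hp (ε⁻¹ • p)]
    refine integral_congr_ae (ae_restrict_of_ae ?_)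
    filter_upwards [ae_comp_add hkk (ε⁻¹ • p)] with q hq
    exact hq 0
  · intro τ hτ
    have h2 : ‖ε • τ‖ < ρ := by
      rw [norm_smul, Real.norm_of_nonneg hε.le]
      exact (mul_le_mul_of_nonneg_left (hC τ hτ) hε.le).trans_lt hεC
    have h3 := hρG (y := ε • τ) (by simpa using h2)
    rw [Real.dist_eq, sub_zero] at h3
    have h3 := (le_abs_self _).trans h3.le
    calc ∫ p, |G p * k' 0 (ε⁻¹ • p) - G (p - ε • τ) * k' 0 (ε⁻¹ • p)| ∂μ
        ≤ ∫ p, |G (p - ε • τ) - G p| * M ∂μ := by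
          refine integral_mono_of_nonneg (Eventually.of_forall fun p => abs_nonneg _)
            (((hG.comp_sub_right _).sub hG).abs.mul_const _) (Eventually.of_forall fun p => ?_)
          simp only
          rw [← sub_mul, abs_mul, abs_sub_comm]
          exact mul_le_mul_of_nonneg_left (hb' _ _) (abs_nonneg _)
      _ = (∫ p, |G (p - ε • τ) - G p| ∂μ) * M := integral_mul_const _ _
      _ ≤ e / (2 * (M + 1)) * M := mul_le_mul_of_nonneg_right h3 hM
      _ ≤ e / 2 := by
          rw [div_mul_eq_mul_div, div_le_div_iff₀ (by positivity) (by positivity)]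
          nlinarith

set_option linter.unusedSectionVars false in
/-- The modulus of continuity in the slow variable, as a function of the fast one, has a
measurable periodic version; its mean tends to zero. -/
theorem exists_modulus {k : Z → Z → ℝ} (hc : ∀ q, Continuous fun p => k p q)
    (hm : ∀ p, AEMeasurable (k p) μ) {M : ℝ} (hb : ∀ p q, |k p q| ≤ M)
    (hp : ∀ p, ∀ g ∈ Γ, ∀ z, k p (z + g) = k p z) (hY1 : μ Y = 1) (R : ℝ) {η : ℝ} (hη : 0 < η) :
    ∃ δ > 0, ∃ ω : Z → ℝ, AEMeasurable ω μ ∧ (∀ q, 0 ≤ ω q) ∧ (∀ q, |ω q| ≤ 2 * M) ∧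
      (∀ g ∈ Γ, ∀ z, ω (z + g) = ω z) ∧ (∫ q in Y, ω q ∂μ) < η ∧
      ∀ q a b, ‖a‖ < R → ‖b - a‖ < δ → |k a q - k b q| ≤ ω q := by
  have hM : 0 ≤ M := (abs_nonneg _).trans (hb 0 0)
  let O : ℕ → Set (Z × Z) := fun n => {x | ‖x.1‖ < R ∧ ‖x.2 - x.1‖ < 1 / ((n : ℝ) + 1)}
  by_cases hR : R ≤ 0
  · refine ⟨1, one_pos, fun _ => 0, aemeasurable_const, fun _ => le_rfl, fun _ => by simpa using hM,
      fun _ _ _ => rfl, by simpa using hη, fun q a b ha => ?_⟩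
    exact absurd ha (not_lt.2 (hR.trans (norm_nonneg a)))
  push Not at hR
  have hne : ∀ n, Nonempty (O n) := fun n => ⟨⟨(0, 0), by simpa using hR, by simp; positivity⟩⟩
  have hdiff : ∀ a b q, |k a q - k b q| ≤ 2 * M := fun a b q =>
    (abs_sub _ _).trans (by linarith [hb a q, hb b q])
  -- A supremum over a countable dense family of pairs stays measurable in `q`, while continuity in
  -- `p` extends the bound to all pairs in `O n`. The family does not depend on `q`, so periodicity
  -- in `q` is inherited.
  let ω : ℕ → Z → ℝ := fun n q =>
    ⨆ i : ℕ, |k (TopologicalSpace.denseSeq (O n) i).1.1 q -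
      k (TopologicalSpace.denseSeq (O n) i).1.2 q|
  have hbdd : ∀ n q, BddAbove (Set.range fun i : ℕ =>
      |k (TopologicalSpace.denseSeq (O n) i).1.1 q -
      k (TopologicalSpace.denseSeq (O n) i).1.2 q|) := fun n q =>
    ⟨2 * M, by rintro _ ⟨i, rfl⟩; exact hdiff _ _ _⟩
  have hωm : ∀ n, AEMeasurable (ω n) μ := fun n =>
    AEMeasurable.iSup fun i => ((hm _).sub (hm _)).abs
  have hω0 : ∀ n q, 0 ≤ ω n q := fun n q => Real.iSup_nonneg fun i => abs_nonneg _
  have hωM : ∀ n q, ω n q ≤ 2 * M := fun n q => ciSup_le fun i => hdiff _ _ _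
  have hωle : ∀ (n : ℕ) q a b, ‖a‖ < R → ‖b - a‖ < 1 / ((n : ℝ) + 1) → |k a q - k b q| ≤ ω n q := by
    intro n q a b ha hab
    have hcl : IsClosed {x : O n | |k x.1.1 q - k x.1.2 q| ≤ ω n q} := by
      refine isClosed_le ?_ continuous_const
      exact (((hc q).comp (continuous_fst.comp continuous_subtype_val)).sub
        ((hc q).comp (continuous_snd.comp continuous_subtype_val))).abs
    have hx : (⟨(a, b), ha, hab⟩ : O n) ∈ {x : O n | |k x.1.1 q - k x.1.2 q| ≤ ω n q} := by
      refine hcl.closure_subset_iff.2 ?_ (TopologicalSpace.denseRange_denseSeq (O n) _)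
      rintro _ ⟨i, rfl⟩
      exact le_ciSup (hbdd n q) i
    exact hx
  have hlim : ∀ q, Tendsto (fun n => ω n q) atTop (𝓝 0) := by
    intro q
    rw [Metric.tendsto_atTop]
    intro e he
    have hU : UniformContinuousOn (fun p => k p q) (Metric.closedBall (0 : Z) (R + 1)) :=
      (isCompact_closedBall _ _).uniformContinuousOn_of_continuous (hc q).continuousOn
    obtain ⟨ρ, hρ, hρk⟩ := Metric.uniformContinuousOn_iff.1 hU (e / 2) (by positivity)
    obtain ⟨N, hN⟩ := exists_nat_one_div_lt hρ
    refine ⟨N, fun n hn => ?_⟩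
    rw [Real.dist_eq, sub_zero, abs_of_nonneg (hω0 n q)]
    refine lt_of_le_of_lt (ciSup_le fun i => ?_) (half_lt_self he)
    obtain ⟨⟨⟨a, b⟩, ha, hab⟩, hi⟩ : ∃ x, TopologicalSpace.denseSeq (O n) i = x := ⟨_, rfl⟩
    rw [hi]
    simp only at ha hab ⊢
    have hn1 : 1 / ((n : ℝ) + 1) ≤ 1 / ((N : ℝ) + 1) :=
      one_div_le_one_div_of_le (by positivity) (by exact_mod_cast Nat.succ_le_succ hn)
    have hn2 : 1 / ((n : ℝ) + 1) ≤ 1 := by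
      rw [div_le_one (by positivity)]
      linarith [(Nat.cast_nonneg n : (0 : ℝ) ≤ n)]
    have hbn : ‖b‖ ≤ R + 1 := by
      have := norm_le_norm_add_norm_sub a b
      rw [norm_sub_rev] at this
      linarith
    have := hρk a (by simpa using by linarith) b (by simpa using hbn) (by
      rw [dist_comm, dist_eq_norm]; linarith)
    rw [Real.dist_eq] at this
    exact this.le
  have hYfin : IsFiniteMeasure (μ.restrict Y) := ⟨by simp [hY1]⟩
  have hint : Tendsto (fun n => ∫ q in Y, ω n q ∂μ) atTop (𝓝 (∫ q in Y, (0 : ℝ) ∂μ)) := by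
    refine tendsto_integral_of_dominated_convergence (fun _ => 2 * M)
      (fun n => (hωm n).restrict.aestronglyMeasurable) (integrable_const _)
      (fun n => Eventually.of_forall fun q => ?_) (Eventually.of_forall hlim)
    rw [Real.norm_of_nonneg (hω0 n q)]
    exact hωM n q
  rw [integral_zero] at hint
  obtain ⟨n, hn⟩ := (hint.eventually (gt_mem_nhds hη)).exists
  refine ⟨1 / ((n : ℝ) + 1), by positivity, ω n, hωm n, hω0 n, fun q => ?_, fun g hg z => ?_, hn,
    hωle n⟩
  · rw [abs_of_nonneg (hω0 n q)]
    exact hωM n q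
  · simp only [ω, hp _ g hg z]

/-- Locally periodic oscillating functions converge weakly-* to their local mean. -/
theorem tendsto_integral_locally_periodic (hY : IsAveragingCell μ Γ Y) {k : Z → Z → ℝ}
    (hc : ∀ q, Continuous fun p => k p q) (hm : ∀ p, AEMeasurable (k p) μ)
    {M : ℝ} (hb : ∀ p q, |k p q| ≤ M) (hp : ∀ p, ∀ g ∈ Γ, ∀ z, k p (z + g) = k p z)
    {G : Z → ℝ} (hG : Integrable G μ) :
    Tendsto (fun ε : ℝ => ∫ p, k p (ε⁻¹ • p) * G p ∂μ) (𝓝[>] 0)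
      (𝓝 (∫ p, (∫ τ in Y, k p τ ∂μ) * G p ∂μ)) := by
  obtain ⟨k', hk', hb', hkk⟩ := exists_measurable_uncurry hc hm hb
  have hM : 0 ≤ M := (abs_nonneg _).trans (hb 0 0)
  obtain ⟨C, hC⟩ := hY.bounded.exists_norm_le
  set I := ∫ p, |G p| ∂μ with hI
  have hI0 : 0 ≤ I := integral_nonneg fun p => abs_nonneg _
  rw [Metric.tendsto_nhds]
  intro e he
  -- tail of `G`
  obtain ⟨R, hR⟩ : ∃ R : ℝ, ∫ p in {p : Z | R ≤ ‖p‖}, |G p| ∂μ < e / (16 * (M + 1)) := by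
    have h1 : Tendsto (fun n : ℕ => ∫ p in {p : Z | (n : ℝ) ≤ ‖p‖}, |G p| ∂μ) atTop
        (𝓝 (∫ p in ⋂ n : ℕ, {p : Z | (n : ℝ) ≤ ‖p‖}, |G p| ∂μ)) := by
      refine tendsto_setIntegral_of_antitone
        (fun n => measurableSet_le measurable_const measurable_norm) ?_ ⟨0, hG.abs.integrableOn⟩
      intro a b hab p hp
      have hp' : (b : ℝ) ≤ ‖p‖ := hp
      exact (Nat.cast_le.2 hab).trans hp'
    have h2 : (⋂ n : ℕ, {p : Z | (n : ℝ) ≤ ‖p‖}) = ∅ := by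
      refine Set.eq_empty_of_forall_notMem fun p hp => ?_
      obtain ⟨n, hn⟩ := exists_nat_gt ‖p‖
      exact absurd (Set.mem_iInter.1 hp n) (not_le.2 hn)
    rw [h2, setIntegral_empty] at h1
    obtain ⟨n, hn⟩ := (h1.eventually (gt_mem_nhds (show 0 < e / (16 * (M + 1)) by positivity))).exists
    exact ⟨n, hn⟩
  obtain ⟨δ, hδ, ω, hωm, hω0, hωb, hωp, hωY, hωk⟩ :=
    exists_modulus (Γ := Γ) hc hm hb hp hY.mass R (η := e / (8 * (I + 1))) (by positivity)
  obtain ⟨ρ, hρ, hρG⟩ := Metric.eventually_nhds_iff.1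
    (Metric.tendsto_nhds.1 (tendsto_integral_abs_translate_sub hG) (e / (4 * (M + 1)))
      (by positivity))
  have hlim : Tendsto (fun ε : ℝ => ε * C) (𝓝[>] 0) (𝓝 0) := by
    have : Tendsto (fun ε : ℝ => ε * C) (𝓝 0) (𝓝 (0 * C)) :=
      tendsto_id.mul_const C
    rw [zero_mul] at this
    exact this.mono_left nhdsWithin_le_nhds
  -- The modulus need not be small uniformly in the fast variable, only in mean. It is itself
  -- periodic, so the case without slow variable converts its small mean into a small `∫ ω(p/ε)|G|`.
  have hωlim := tendsto_integral_periodic hY hωm hωb hωp hG.abs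
  rw [integral_const_mul, ← hI] at hωlim
  have hωI : (∫ τ in Y, ω τ ∂μ) * I < e / 4 := by
    calc (∫ τ in Y, ω τ ∂μ) * I ≤ e / (8 * (I + 1)) * I := by gcongr
      _ < e / 4 := by
        rw [div_mul_eq_mul_div, div_lt_div_iff₀ (by positivity) (by positivity)]
        nlinarith
  filter_upwards [self_mem_nhdsWithin, hlim.eventually (gt_mem_nhds hρ),
    hlim.eventually (gt_mem_nhds hδ), hωlim.eventually (gt_mem_nhds hωI)] with ε hε hεC hεδ hεω
  have hε : 0 < ε := hε
  have hkε := ae_comp_inv_smul hkk hε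
  have h1 : ∫ p, k p (ε⁻¹ • p) * G p ∂μ = ∫ p, k' p (ε⁻¹ • p) * G p ∂μ := by
    refine integral_congr_ae ?_
    filter_upwards [hkε] with p hp
    simp only [hp]
  rw [Real.dist_eq, h1]
  refine lt_of_le_of_lt (abs_integral_rescaled_sub_le (η := 7 * e / 8) hY.mass
    hk' hb' hε (c := fun p => ∫ τ in Y, k p τ ∂μ) ?_ hG ?_) (by linarith)
  · intro p
    rw [← hY.average (k p) (hp p) (ε⁻¹ • p)]
    refine integral_congr_ae (ae_restrict_of_ae ?_)
    filter_upwards [ae_comp_add hkk (ε⁻¹ • p)] with q hq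
    exact hq p
  · intro τ hτ
    have hn : ‖ε • τ‖ ≤ ε * C := by
      rw [norm_smul, Real.norm_of_nonneg hε.le]
      exact mul_le_mul_of_nonneg_left (hC τ hτ) hε.le
    have h3 := hρG (y := ε • τ) (by simpa using hn.trans_lt hεC)
    rw [Real.dist_eq, sub_zero] at h3
    have h3 := (le_abs_self _).trans h3.le
    have i1 : Integrable (fun p => |G (p - ε • τ) - G p| * M) μ :=
      ((hG.comp_sub_right _).sub hG).abs.mul_const _
    have i2 : Integrable (fun p => ω (ε⁻¹ • p) * |G p|) μ := by
      refine Integrable.bdd_mul (c := 2 * M) hG.abs ?_ (Eventually.of_forall fun p => hωb _)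
      exact (hωm.comp_quasiMeasurePreserving
        (Measure.quasiMeasurePreserving_smul μ (inv_ne_zero hε.ne'))).aestronglyMeasurable
    have hRm : MeasurableSet {p : Z | R ≤ ‖p‖} := measurableSet_le measurable_const measurable_norm
    have i3 : Integrable ({p : Z | R ≤ ‖p‖}.indicator fun p => 2 * M * |G p|) μ :=
      (hG.abs.const_mul _).indicator hRm
    calc ∫ p, |G p * k' p (ε⁻¹ • p) - G (p - ε • τ) * k' (p - ε • τ) (ε⁻¹ • p)| ∂μ
        ≤ ∫ p, (|G (p - ε • τ) - G p| * M + ω (ε⁻¹ • p) * |G p| +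
            {p : Z | R ≤ ‖p‖}.indicator (fun p => 2 * M * |G p|) p) ∂μ := by
          refine integral_mono_of_nonneg (Eventually.of_forall fun p => abs_nonneg _)
            ((i1.add i2).add i3) ?_
          filter_upwards [hkε] with p hp
          -- The first term is paid for by continuity of translation in `L¹`; the second by `ω(p/ε)`
          -- inside the ball of radius `R`, and by `2M` times the tail of `G` outside.
          have hdec : G p * k' p (ε⁻¹ • p) - G (p - ε • τ) * k' (p - ε • τ) (ε⁻¹ • p) =
              (G p - G (p - ε • τ)) * k' (p - ε • τ) (ε⁻¹ • p) +
                G p * (k p (ε⁻¹ • p) - k (p - ε • τ) (ε⁻¹ • p)) := by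
            rw [hp, hp]; ring
          have hle1 : |(G p - G (p - ε • τ)) * k' (p - ε • τ) (ε⁻¹ • p)| ≤
              |G (p - ε • τ) - G p| * M := by
            rw [abs_mul, abs_sub_comm]
            exact mul_le_mul_of_nonneg_left (hb' _ _) (abs_nonneg _)
          have hle2 : |G p * (k p (ε⁻¹ • p) - k (p - ε • τ) (ε⁻¹ • p))| ≤
              ω (ε⁻¹ • p) * |G p| + {p : Z | R ≤ ‖p‖}.indicator (fun p => 2 * M * |G p|) p := by
            rw [abs_mul, mul_comm]
            by_cases h : ‖p‖ < R
            · have h4 := hωk (ε⁻¹ • p) p (p - ε • τ) h (by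
                simpa using hn.trans_lt hεδ)
              rw [Set.indicator_of_notMem (by simpa using h), add_zero]
              exact mul_le_mul_of_nonneg_right h4 (abs_nonneg _)
            · rw [Set.indicator_of_mem (by simpa using h)]
              have h4 : |k p (ε⁻¹ • p) - k (p - ε • τ) (ε⁻¹ • p)| ≤ 2 * M :=
                (abs_sub _ _).trans (by linarith [hb p (ε⁻¹ • p), hb (p - ε • τ) (ε⁻¹ • p)])
              have h5 := mul_nonneg (hω0 (ε⁻¹ • p)) (abs_nonneg (G p))
              have h6 := mul_le_mul_of_nonneg_right h4 (abs_nonneg (G p))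
              linarith
          rw [hdec]
          refine (abs_add_le _ _).trans ?_
          rw [add_assoc]
          exact add_le_add hle1 hle2
      _ = (∫ p, |G (p - ε • τ) - G p| ∂μ) * M + ∫ p, ω (ε⁻¹ • p) * |G p| ∂μ +
            2 * M * ∫ p in {p : Z | R ≤ ‖p‖}, |G p| ∂μ := by
          have i12 : Integrable (fun p => |G (p - ε • τ) - G p| * M + ω (ε⁻¹ • p) * |G p|) μ :=
            i1.add i2
          rw [integral_add i12 i3, integral_add i1 i2, integral_indicator hRm,
            integral_const_mul, integral_mul_const]
      _ ≤ e / (4 * (M + 1)) * M + e / 4 + 2 * M * (e / (16 * (M + 1))) := by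
          gcongr
      _ ≤ 7 * e / 8 := by
          have h5 : M / (M + 1) ≤ 1 := by
            rw [div_le_one (by positivity)]; linarith
          have h6 : e / (4 * (M + 1)) * M + e / 4 + 2 * M * (e / (16 * (M + 1))) =
            e / 4 + 3 / 8 * e * (M / (M + 1)) := by field_simp; ring
          rw [h6]
          nlinarith

end WeakStar

/-! ### Grid cells and averaging over periods -/

instance isAddHaarMeasure_volume_prod {d : ℕ} :
    (volume : Measure (Euc d × Euc d)).IsAddHaarMeasure :=
  inferInstanceAs ((volume : Measure (Euc d)).prod (volume : Measure (Euc d))).IsAddHaarMeasure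

section Cells

variable {d : ℕ}

/-- The half-open cell of the cubic grid of step `δ` with index `k`. -/
def gridCell (δ : ℝ) (k : Fin d → ℤ) : Set (Euc d) :=
  {x | ∀ i, x i ∈ Set.Ico (δ * k i) (δ * (k i + 1))}

theorem gridCell_eq_preimage (δ : ℝ) (k : Fin d → ℤ) :
    gridCell δ k = WithLp.ofLp ⁻¹'
      Set.univ.pi fun i => Set.Ico (δ * (k i : ℝ)) (δ * (k i + 1)) := by
  ext x; simp [gridCell]

theorem measurableSet_gridCell (δ : ℝ) (k : Fin d → ℤ) : MeasurableSet (gridCell δ k) := by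
  rw [gridCell_eq_preimage]
  exact (PiLp.volume_preserving_ofLp (Fin d)).measurable
    (MeasurableSet.univ_pi fun i => measurableSet_Ico)

theorem volume_gridCell {δ : ℝ} (hδ : 0 < δ) (k : Fin d → ℤ) :
    volume (gridCell δ k) = ENNReal.ofReal (δ ^ d) := by
  rw [gridCell_eq_preimage, (PiLp.volume_preserving_ofLp (Fin d)).measure_preimage
    (MeasurableSet.univ_pi fun i => measurableSet_Ico).nullMeasurableSet, Real.volume_pi_Ico]
  have : ∀ i, δ * ((k i : ℝ) + 1) - δ * k i = δ := fun i => by ring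
  simp [this, ENNReal.ofReal_pow hδ.le]

/-- The sum of the coordinate differences gives the crude factor `d` in place of `√d`; only the
power of `δ` matters later. -/
theorem norm_sub_le_of_mem_gridCell {δ : ℝ} {k : Fin d → ℤ} {x y : Euc d}
    (hx : x ∈ gridCell δ k) (hy : y ∈ gridCell δ k) : ‖x - y‖ ≤ d * δ := by
  have h : x - y = ∑ i, (x - y) i • EuclideanSpace.single i (1 : ℝ) := by
    have := (EuclideanSpace.basisFun (Fin d) ℝ).sum_repr (x - y)
    simpa using this.symm
  rw [h]
  refine (norm_sum_le _ _).trans ?_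
  have : ∀ i ∈ Finset.univ, ‖(x - y) i • EuclideanSpace.single i (1 : ℝ)‖ ≤ δ := by
    intro i _
    have h1 := hx i
    have h2 := hy i
    rw [Set.mem_Ico] at h1 h2
    rw [norm_smul, PiLp.norm_single, norm_one, mul_one, Real.norm_eq_abs, abs_le]
    simp only [PiLp.sub_apply]
    constructor <;> nlinarith
  refine (Finset.sum_le_sum this).trans ?_
  simp

/-- The cell containing a point. -/
def cellIndex (δ : ℝ) (x : Euc d) : Fin d → ℤ := fun i => ⌊x i / δ⌋

theorem mem_gridCell_iff {δ : ℝ} (hδ : 0 < δ) {k : Fin d → ℤ} {x : Euc d} :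
    x ∈ gridCell δ k ↔ k = cellIndex δ x := by
  simp only [gridCell, cellIndex, funext_iff]
  refine forall_congr' fun i => ?_
  rw [eq_comm, Int.floor_eq_iff, Set.mem_Ico, le_div_iff₀ hδ, div_lt_iff₀ hδ, mul_comm δ,
    mul_comm δ]

/-- The fundamental domain of the integer lattice is half-open, whereas the effective coefficients
integrate over the closed cell; the faces are null. -/
theorem ae_unitCell_eq_gridCell : unitCell d =ᵐ[volume] gridCell (d := d) 1 0 := by
  have h : (Set.univ.pi fun i : Fin d => Set.Ico (0 : ℝ) 1) =ᵐ[volume]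
      Set.univ.pi fun i : Fin d => Set.Icc (0 : ℝ) 1 :=
    Measure.pi_Ico_ae_eq_pi_Icc
  have h' := (PiLp.volume_preserving_ofLp (Fin d)).quasiMeasurePreserving.preimage_ae_eq h
  have e1 : unitCell d = WithLp.ofLp ⁻¹' Set.univ.pi fun i : Fin d => Set.Icc (0 : ℝ) 1 := by
    ext x; simp [unitCell, Pi.le_def, forall_and]
  rw [gridCell_eq_preimage, e1]
  simpa using h'.symm

theorem volume_unitCell : volume (unitCell d) = 1 := by
  rw [measure_congr ae_unitCell_eq_gridCell, volume_gridCell one_pos]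
  simp

theorem isBounded_unitCell : Bornology.IsBounded (unitCell d) := by
  have : unitCell d = (EuclideanSpace.equiv (Fin d) ℝ) ⁻¹' Set.Icc 0 1 := by
    ext x; simp [unitCell, Set.mem_Icc, Pi.le_def, forall_and]
  rw [this]
  have hc : IsCompact ((EuclideanSpace.equiv (Fin d) ℝ) ⁻¹' (Set.Icc (0 : Fin d → ℝ) 1)) :=
    (EuclideanSpace.equiv (Fin d) ℝ).toHomeomorph.isClosedEmbedding.isCompact_preimage isCompact_Icc
  exact hc.isBounded

end Cells

open scoped Pointwise in
/-- A bounded set of unit mass which agrees a.e. with the fundamental parallelepiped of a basis is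
an averaging cell for functions periodic along that basis. -/
theorem isAveragingCell_of_basis {Z : Type*} [NormedAddCommGroup Z] [NormedSpace ℝ Z]
    [FiniteDimensional ℝ Z] [MeasurableSpace Z] [BorelSpace Z] {μ : Measure Z} [μ.IsAddHaarMeasure]
    {ι : Type*} [Finite ι] (b : Module.Basis ι ℝ Z) {Y : Set Z} (hYb : Bornology.IsBounded Y)
    (hY1 : μ Y = 1) (hY : Y =ᵐ[μ] ZSpan.fundamentalDomain b) :
    IsAveragingCell μ (Set.range b) Y := by
  refine ⟨hYb, hY1, fun h hp z => ?_⟩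
  -- Periodicity along the basis vectors extends to the lattice they generate. A translate of the
  -- fundamental parallelepiped is again a fundamental domain of that lattice, and lattice-invariant
  -- functions have the same integral over any two of them.
  have hper : ∀ g ∈ Submodule.span ℤ (Set.range b), ∀ x, h (x + g) = h x := by
    intro g hg
    induction hg using Submodule.span_induction with
    | mem g hg => exact hp g hg
    | zero => simp
    | add g g' _ _ ih ih' => intro x; rw [← add_assoc, ih', ih]
    | smul n g _ ih =>
      intro x
      induction n using Int.induction_on generalizing x with
      | zero => simp
      | succ n ihn => rw [add_smul, one_smul, ← add_assoc, ih, ihn]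
      | pred n ihn =>
        rw [sub_smul, one_smul, ← ih (x + _), add_assoc, sub_add_cancel, ihn]
  have hfd := ZSpan.isAddFundamentalDomain' b μ
  have : Countable (Submodule.span ℤ (Set.range b)).toAddSubgroup :=
    inferInstanceAs (Countable (Submodule.span ℤ (Set.range b)))
  have hfd' := hfd.vadd_of_comm z
  have := hfd'.setIntegral_eq hfd (f := h) (fun g x => by
    rw [AddSubgroup.vadd_def, vadd_eq_add, add_comm]
    exact hper g g.2 x)
  rw [setIntegral_congr_set hY, setIntegral_congr_set hY, ← this]
  have e : z +ᵥ ZSpan.fundamentalDomain b = (fun x => z + x) '' ZSpan.fundamentalDomain b := by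
    rw [← Set.image_vadd]; rfl
  rw [e, (measurePreserving_add_left μ z).setIntegral_image_emb
    (measurableEmbedding_addLeft z)]

/-- The coordinate directions of `ℝ^d × ℝ^d`. -/
def pairPeriods (d : ℕ) : Set (Euc d × Euc d) :=
  Set.range ((EuclideanSpace.basisFun (Fin d) ℝ).toBasis.prod
    (EuclideanSpace.basisFun (Fin d) ℝ).toBasis)

theorem isAveragingCell_pair (d : ℕ) :
    IsAveragingCell (volume : Measure (Euc d × Euc d)) (pairPeriods d)
      (unitCell d ×ˢ unitCell d) := by
  refine isAveragingCell_of_basis _ (isBounded_unitCell.prod isBounded_unitCell) ?_ ?_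
  · rw [Measure.volume_eq_prod, Measure.prod_prod, volume_unitCell, one_mul]
  · have h : unitCell d ×ˢ unitCell d =ᵐ[(volume : Measure (Euc d × Euc d))]
        gridCell (d := d) 1 0 ×ˢ gridCell (d := d) 1 0 :=
      Measure.set_prod_ae_eq ae_unitCell_eq_gridCell ae_unitCell_eq_gridCell
    have e : gridCell (d := d) 1 0 ×ˢ gridCell (d := d) 1 0 = ZSpan.fundamentalDomain
        ((EuclideanSpace.basisFun (Fin d) ℝ).toBasis.prod
          (EuclideanSpace.basisFun (Fin d) ℝ).toBasis) := by
      ext x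
      simp [ZSpan.mem_fundamentalDomain, gridCell]
    rwa [e] at h

/-- Functions that are `1`-periodic in both variables have the coordinate directions as periods. -/
theorem periodic_pair {d : ℕ} {h : Euc d × Euc d → ℝ}
    (h1 : ∀ η, UnitPeriodic fun ξ => h (ξ, η)) (h2 : ∀ ξ, UnitPeriodic fun η => h (ξ, η)) :
    ∀ g ∈ pairPeriods d, ∀ z, h (z + g) = h z := by
  rintro _ ⟨i | i, rfl⟩ ⟨ξ, η⟩
  · simpa [Module.Basis.prod_apply] using h1 η i ξ
  · simpa [Module.Basis.prod_apply] using h2 ξ i η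

/-! ### Bounded bilinear forms on `L²` given by a weight -/

section WeightedForm

variable {X : Type*} [MeasurableSpace X] {μ : Measure X}

/-- The bilinear form `∫ a f g` on `L²`. -/
def weightedForm (a : X → ℝ) (f g : Lp ℝ 2 μ) : ℝ := ∫ x, a x * (f x * g x) ∂μ

theorem integrable_mul_L2 (f g : Lp ℝ 2 μ) : Integrable (fun x => f x * g x) μ := by
  simpa [mul_comm] using L2.integrable_inner (𝕜 := ℝ) f g

theorem integral_mul_self_L2 (f : Lp ℝ 2 μ) : ∫ x, f x * f x ∂μ = ‖f‖ ^ 2 := by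
  rw [← real_inner_self_eq_norm_sq, L2.inner_def]
  simp [pow_two]

theorem integral_abs_mul_le_L2 (f g : Lp ℝ 2 μ) : ∫ x, |f x * g x| ∂μ ≤ ‖f‖ * ‖g‖ := by
  have h := abs_real_inner_le_norm |f| |g|
  rw [norm_abs_eq_norm, norm_abs_eq_norm, L2.inner_def] at h
  refine le_trans (le_of_eq ?_) ((le_abs_self _).trans h)
  refine integral_congr_ae ?_
  filter_upwards [Lp.coeFn_abs f, Lp.coeFn_abs g] with x hf hg
  simp [hf, hg, abs_mul, mul_comm]

variable {a : X → ℝ} {M : ℝ}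

theorem integrable_weighted (ha : AEMeasurable a μ) (hb : ∀ x, |a x| ≤ M) {g : X → ℝ}
    (hg : Integrable g μ) : Integrable (fun x => a x * g x) μ :=
  hg.bdd_mul ha.aestronglyMeasurable (Eventually.of_forall hb)

theorem weightedForm_add_left (ha : AEMeasurable a μ) (hb : ∀ x, |a x| ≤ M) (f f' g : Lp ℝ 2 μ) :
    weightedForm a (f + f') g = weightedForm a f g + weightedForm a f' g := by
  rw [weightedForm, weightedForm, weightedForm, ← integral_add
    (integrable_weighted ha hb (integrable_mul_L2 f g))
    (integrable_weighted ha hb (integrable_mul_L2 f' g))]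
  refine integral_congr_ae ?_
  filter_upwards [Lp.coeFn_add f f'] with x hx
  rw [hx, Pi.add_apply]
  ring

theorem weightedForm_comm (f g : Lp ℝ 2 μ) : weightedForm a f g = weightedForm a g f := by
  simp only [weightedForm, mul_comm]

theorem weightedForm_smul_left (c : ℝ) (f g : Lp ℝ 2 μ) :
    weightedForm a (c • f) g = c * weightedForm a f g := by
  rw [weightedForm, weightedForm, ← integral_const_mul]
  refine integral_congr_ae ?_
  filter_upwards [Lp.coeFn_smul c f] with x hx
  rw [hx, Pi.smul_apply, smul_eq_mul]
  ring

theorem abs_weightedForm_le (hb : ∀ x, |a x| ≤ M) (hM : 0 ≤ M) (f g : Lp ℝ 2 μ) :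
    |weightedForm a f g| ≤ M * ‖f‖ * ‖g‖ := by
  calc |weightedForm a f g| ≤ ∫ x, M * |f x * g x| ∂μ := by
        rw [weightedForm, ← Real.norm_eq_abs]
        refine norm_integral_le_of_norm_le ((integrable_mul_L2 f g).abs.const_mul M)
          (Eventually.of_forall fun x => ?_)
        rw [Real.norm_eq_abs, abs_mul]
        exact mul_le_mul_of_nonneg_right (hb x) (abs_nonneg _)
    _ = M * ∫ x, |f x * g x| ∂μ := integral_const_mul _ _
    _ ≤ M * (‖f‖ * ‖g‖) := mul_le_mul_of_nonneg_left (integral_abs_mul_le_L2 f g) hM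
    _ = _ := by ring

theorem le_weightedForm_self (ha : AEMeasurable a μ) (hb : ∀ x, |a x| ≤ M) {c : ℝ}
    (hc : ∀ x, c ≤ a x) (f : Lp ℝ 2 μ) : c * ‖f‖ ^ 2 ≤ weightedForm a f f := by
  rw [← integral_mul_self_L2, ← integral_const_mul]
  exact integral_mono ((integrable_mul_L2 f f).const_mul c)
    (integrable_weighted ha hb (integrable_mul_L2 f f)) fun x =>
      mul_le_mul_of_nonneg_right (hc x) (mul_self_nonneg _)

/-- The weighted form as a continuous bilinear map. -/
def weightedFormCLM (ha : AEMeasurable a μ) (hb : ∀ x, |a x| ≤ M) (hM : 0 ≤ M) :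
    Lp ℝ 2 μ →L[ℝ] Lp ℝ 2 μ →L[ℝ] ℝ :=
  LinearMap.mkContinuous₂
    (LinearMap.mk₂ ℝ (weightedForm a) (weightedForm_add_left ha hb)
      (fun c f g => weightedForm_smul_left c f g)
      (fun f g g' => by
        rw [weightedForm_comm, weightedForm_add_left ha hb, weightedForm_comm,
          weightedForm_comm g'])
      (fun c f g => by
        rw [weightedForm_comm, weightedForm_smul_left, weightedForm_comm, smul_eq_mul])) M
    (fun f g => abs_weightedForm_le hb hM f g)

end WeightedForm

/-! ### The Hilbert space `H^s` and solvability of the weak equation -/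

section Sobolev

variable {d : ℕ} {s : ℝ}

/-- The difference quotient is a pointwise expression in `u`, so it passes to the limit along a
subsequence converging a.e. in both components. Completeness of `H^s`, needed for Lax–Milgram,
follows. -/
theorem isClosed_fracSobolev (d : ℕ) (s : ℝ) :
    IsClosed (fracSobolev d s : Set (WithLp 2 (L2 d × L2Pair d))) := by
  refine IsSeqClosed.isClosed fun w w₀ hw hlim => ?_
  have h1 : Tendsto (fun n => (w n).fst) atTop (𝓝 w₀.fst) :=
    ((WithLp.fstL 2 ℝ (L2 d) (L2Pair d)).continuous.tendsto w₀).comp hlim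
  have h2 : Tendsto (fun n => (w n).snd) atTop (𝓝 w₀.snd) :=
    ((WithLp.sndL 2 ℝ (L2 d) (L2Pair d)).continuous.tendsto w₀).comp hlim
  obtain ⟨φ, hφ, hφae⟩ := (tendstoInMeasure_of_tendsto_Lp h1).exists_seq_tendsto_ae
  obtain ⟨ψ, hψ, hψae⟩ := (tendstoInMeasure_of_tendsto_Lp
    (h2.comp hφ.tendsto_atTop)).exists_seq_tendsto_ae
  have q1 := (Measure.quasiMeasurePreserving_fst
    (μ := (volume : Measure (Euc d))) (ν := (volume : Measure (Euc d)))).ae hφae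
  have q2 := (Measure.quasiMeasurePreserving_snd
    (μ := (volume : Measure (Euc d))) (ν := (volume : Measure (Euc d)))).ae hφae
  have hw' : ∀ᵐ p : Euc d × Euc d, ∀ n, (w n).snd p = fracDiff s ((w n).fst : Euc d → ℝ) p :=
    ae_all_iff.2 fun n => hw n
  change (w₀.snd : Euc d × Euc d → ℝ) =ᵐ[volume] fracDiff s (w₀.fst : Euc d → ℝ)
  filter_upwards [hψae, q1, q2, hw'] with p hp hp1 hp2 hpw
  refine tendsto_nhds_unique hp ?_
  simp only [Function.comp_apply, hpw]
  exact ((hp2.comp hψ.tendsto_atTop).sub (hp1.comp hψ.tendsto_atTop)).div_const _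

instance completeSpace_fracSobolev : CompleteSpace (fracSobolev d s) :=
  (isClosed_fracSobolev d s).completeSpace_coe

/-- `toL2` as a continuous linear map. -/
def toL2CLM : fracSobolev d s →L[ℝ] L2 d :=
  (WithLp.fstL 2 ℝ (L2 d) (L2Pair d)).comp (fracSobolev d s).subtypeL

/-- The difference quotient as a continuous linear map `H^s(ℝ^d) → L²(ℝ^d × ℝ^d)`. -/
def diffQuot : fracSobolev d s →L[ℝ] L2Pair d :=
  (WithLp.sndL 2 ℝ (L2 d) (L2Pair d)).comp (fracSobolev d s).subtypeL

theorem diffQuot_ae (u : fracSobolev d s) :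
    (diffQuot u : Euc d × Euc d → ℝ) =ᵐ[volume] fracDiff s (toL2 u) := u.2

theorem norm_sq_eq_add (u : fracSobolev d s) : ‖u‖ ^ 2 = ‖toL2 u‖ ^ 2 + ‖diffQuot u‖ ^ 2 :=
  WithLp.prod_norm_sq_eq_of_L2 _

theorem norm_toL2_le (u : fracSobolev d s) : ‖toL2 u‖ ≤ ‖u‖ := by
  refine le_of_sq_le_sq ?_ (norm_nonneg _)
  rw [norm_sq_eq_add]
  linarith [sq_nonneg ‖diffQuot u‖]

theorem norm_diffQuot_le (u : fracSobolev d s) : ‖diffQuot u‖ ≤ ‖u‖ := by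
  refine le_of_sq_le_sq ?_ (norm_nonneg _)
  rw [norm_sq_eq_add]
  linarith [sq_nonneg ‖toL2 u‖]

/-- `½ ∫∫ κ Du Dv + m ∫ w u v = - ∫ w f v` for all `v ∈ H^s`. -/
def IsWeakSolution (κ : Euc d × Euc d → ℝ) (w : Euc d → ℝ) (m : ℝ) (f : L2 d)
    (u : fracSobolev d s) : Prop :=
  ∀ v : fracSobolev d s, (1 / 2) * weightedForm κ (diffQuot u) (diffQuot v) +
    m * weightedForm w (toL2 u) (toL2 v) = -weightedForm w f (toL2 v)

/-- The singular kernel `|x - y|^{-d-α}` is shared equally between the two difference quotients,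
leaving the bounded coefficient `Λ(x,y) ν(x)` as the only weight. -/
theorem levyForm_eq_weightedForm (α : ℝ) (Λ : Euc d → Euc d → ℝ) (ν : Euc d → ℝ)
    (u v : fracSobolev d (α / 2)) :
    levyForm α Λ ν (toL2 u) (toL2 v) =
      (1 / 2) * weightedForm (fun p => Λ p.1 p.2 * ν p.1) (diffQuot u) (diffQuot v) := by
  rw [levyForm, weightedForm]
  congr 1
  refine integral_congr_ae ?_
  filter_upwards [diffQuot_ae u, diffQuot_ae v] with p hu hv
  have hp : ‖p.1 - p.2‖ ^ ((d : ℝ) + α) =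
      ‖p.1 - p.2‖ ^ ((d : ℝ) / 2 + α / 2) * ‖p.1 - p.2‖ ^ ((d : ℝ) / 2 + α / 2) := by
    rw [← pow_two, ← Real.rpow_mul_natCast (norm_nonneg _)]
    congr 1
    push_cast
    ring
  rw [hu, hv, fracDiff, fracDiff, hp, div_mul_div_comm]
  ring

/-- The resolvent equation in weak form. -/
theorem isResolventSolution_iff {α : ℝ} {Λ : Euc d → Euc d → ℝ} {ν : Euc d → ℝ}
    (hν : AEMeasurable ν) {M : ℝ} (hb : ∀ x, |ν x| ≤ M) {m : ℝ} {f : L2 d}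
    {u : fracSobolev d (α / 2)} :
    IsResolventSolution α Λ ν m f u ↔
      IsWeakSolution (fun p => Λ p.1 p.2 * ν p.1) ν m f u := by
  have key : ∀ v : fracSobolev d (α / 2), ∫ x, (f + m • toL2 u) x * toL2 v x * ν x =
      weightedForm ν f (toL2 v) + m * weightedForm ν (toL2 u) (toL2 v) := by
    intro v
    rw [← weightedForm_smul_left, ← weightedForm_add_left hν hb, weightedForm]
    simp only [mul_comm]
  constructor
  · rintro ⟨g, hg, hgf⟩ v
    have h := hg v
    rw [eq_add_of_sub_eq hgf, key, levyForm_eq_weightedForm] at h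
    linarith
  · intro h
    refine ⟨f + m • toL2 u, fun v => ?_, by simp⟩
    rw [key, levyForm_eq_weightedForm]
    linarith [h v]

/-- Existence and uniqueness of weak solutions. -/
theorem existsUnique_isWeakSolution {κ : Euc d × Euc d → ℝ} {w : Euc d → ℝ}
    (hκ : AEMeasurable κ) (hw : AEMeasurable w) {c M : ℝ} (hc : 0 < c)
    (hκc : ∀ p, c ≤ κ p) (hκM : ∀ p, |κ p| ≤ M) (hwc : ∀ x, c ≤ w x) (hwM : ∀ x, |w x| ≤ M)
    {m : ℝ} (hm : 0 < m) (f : L2 d) :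
    ∃! u : fracSobolev d s, IsWeakSolution κ w m f u := by
  have hM : 0 ≤ M := (abs_nonneg _).trans (hwM 0)
  let B : fracSobolev d s →L[ℝ] fracSobolev d s →L[ℝ] ℝ :=
    (1 / 2 : ℝ) • (weightedFormCLM hκ hκM hM).bilinearComp diffQuot diffQuot +
      m • (weightedFormCLM hw hwM hM).bilinearComp toL2CLM toL2CLM
  have hB : ∀ u v, B u v = (1 / 2) * weightedForm κ (diffQuot u) (diffQuot v) +
      m * weightedForm w (toL2 u) (toL2 v) := fun u v => rfl
  have hco : IsCoercive B := by
    refine ⟨c * min (1 / 2) m, by positivity, fun u => ?_⟩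
    rw [hB, mul_assoc, ← pow_two, norm_sq_eq_add]
    have h1 := le_weightedForm_self hκ hκM hκc (diffQuot u)
    have h2 := le_weightedForm_self hw hwM hwc (toL2 u)
    have h3 : min (1 / 2) m * (c * ‖toL2 u‖ ^ 2) ≤ m * (c * ‖toL2 u‖ ^ 2) :=
      mul_le_mul_of_nonneg_right (min_le_right _ _) (by positivity)
    have h4 : min (1 / 2) m * (c * ‖diffQuot u‖ ^ 2) ≤ 1 / 2 * (c * ‖diffQuot u‖ ^ 2) :=
      mul_le_mul_of_nonneg_right (min_le_left _ _) (by positivity)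
    nlinarith
  -- The right-hand side is represented by a vector `r` (Riesz); solving the equation then means
  -- inverting the Lax–Milgram isomorphism of `B` at `r`.
  let ℓ : fracSobolev d s →L[ℝ] ℝ := -((weightedFormCLM hw hwM hM f).comp toL2CLM)
  have hℓ : ∀ v, ℓ v = -weightedForm w f (toL2 v) := fun v => rfl
  let r := (InnerProductSpace.toDual ℝ (fracSobolev d s)).symm ℓ
  have hr : ∀ v, inner ℝ r v = ℓ v := fun v => InnerProductSpace.toDual_symm_apply
  have hsol : ∀ u, IsWeakSolution κ w m f u ↔ hco.continuousLinearEquivOfBilin u = r := by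
    intro u
    rw [IsWeakSolution]
    simp_rw [← hB, ← hℓ, ← hr, ← hco.continuousLinearEquivOfBilin_apply]
    exact ⟨fun h => ext_inner_right ℝ h, fun h v => by rw [h]⟩
  refine ⟨hco.continuousLinearEquivOfBilin.symm r, (hsol _).2 (by simp), fun u hu => ?_⟩
  rw [← (hsol u).1 hu]
  simp

end Sobolev

/-! ### Fractional Poincaré inequality and local compactness -/

section LocalCompactness

variable {d : ℕ} {s : ℝ}

theorem volume_gridCell_ne_top {δ : ℝ} (hδ : 0 < δ) (k : Fin d → ℤ) :
    volume (gridCell δ k) ≠ ⊤ := by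
  rw [volume_gridCell hδ]
  exact ENNReal.ofReal_ne_top

/-- The normalized indicator of a grid cell, as an element of `L²`. -/
def cellIndicator {δ : ℝ} (hδ : 0 < δ) (k : Fin d → ℤ) : L2 d :=
  indicatorConstLp 2 (measurableSet_gridCell δ k) (volume_gridCell_ne_top hδ k) (1 : ℝ)

/-- The indices of the grid cells that meet the ball of radius `R`. -/
def cellIndices (d : ℕ) (δ R : ℝ) : Finset (Fin d → ℤ) :=
  Finset.Icc (fun _ => ⌊-R / δ⌋) (fun _ => ⌊R / δ⌋)

theorem cellIndex_mem {δ R : ℝ} (hδ : 0 < δ) {x : Euc d} (hx : ‖x‖ ≤ R) :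
    cellIndex δ x ∈ cellIndices d δ R := by
  have h : ∀ i, -R ≤ x i ∧ x i ≤ R := fun i => by
    have := (PiLp.norm_apply_le x i).trans hx
    rwa [Real.norm_eq_abs, abs_le] at this
  rw [cellIndices, Finset.mem_Icc]
  exact ⟨fun i => Int.floor_mono (div_le_div_of_nonneg_right (h i).1 hδ.le),
    fun i => Int.floor_mono (div_le_div_of_nonneg_right (h i).2 hδ.le)⟩

/-- Piecewise constant approximation by averages over the grid cells that meet a ball. -/
def cellAverage {δ : ℝ} (hδ : 0 < δ) (R : ℝ) (w : L2 d) : L2 d :=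
  ∑ k ∈ cellIndices d δ R, ((δ ^ d)⁻¹ * ∫ y in gridCell δ k, w y) • cellIndicator hδ k

theorem coeFn_sum_smul_ae {X ι : Type*} [MeasurableSpace X] {μ : Measure X} (F : Finset ι)
    (c : ι → ℝ) (g : ι → Lp ℝ 2 μ) :
    ((∑ k ∈ F, c k • g k : Lp ℝ 2 μ) : X → ℝ) =ᵐ[μ] fun x => ∑ k ∈ F, c k * g k x := by
  classical
  induction F using Finset.induction_on with
  | empty =>
    filter_upwards [Lp.coeFn_zero ℝ 2 μ] with x hx
    simp only [Finset.sum_empty]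
    exact hx
  | insert k F hk ih =>
    rw [Finset.sum_insert hk]
    filter_upwards [Lp.coeFn_add (c k • g k) (∑ k ∈ F, c k • g k), Lp.coeFn_smul (c k) (g k), ih]
      with x h1 h2 h3
    rw [h1, Pi.add_apply, h2, h3, Finset.sum_insert hk, Pi.smul_apply, smul_eq_mul]

theorem cellAverage_ae {δ : ℝ} (hδ : 0 < δ) (R : ℝ) (w : L2 d) :
    ∀ᵐ x : Euc d, ‖x‖ ≤ R →
      cellAverage hδ R w x = (δ ^ d)⁻¹ * ∫ y in gridCell δ (cellIndex δ x), w y := by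
  have hind : ∀ᵐ x : Euc d, ∀ k : Fin d → ℤ,
      cellIndicator hδ k x = (gridCell δ k).indicator (fun _ => (1 : ℝ)) x :=
    ae_all_iff.2 fun k => indicatorConstLp_coeFn
  filter_upwards [hind, coeFn_sum_smul_ae (cellIndices d δ R)
    (fun k => (δ ^ d)⁻¹ * ∫ y in gridCell δ k, w y) (cellIndicator hδ)] with x hx hsum hxR
  rw [cellAverage, hsum, Finset.sum_eq_single (cellIndex δ x)]
  · rw [hx, Set.indicator_of_mem ((mem_gridCell_iff hδ).2 rfl), mul_one]
  · intro k _ hk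
    rw [hx, Set.indicator_of_notMem (fun h => hk ((mem_gridCell_iff hδ).1 h)), mul_zero]
  · intro h
    exact absurd (cellIndex_mem hδ hxR) h

/-- The square of a mean is at most the mean of the square. -/
theorem sq_sub_average_le {X : Type*} [MeasurableSpace X] {μ : Measure X} {Q : Set X} {V : ℝ}
    (hV : 0 < V) (hQ : μ Q = ENNReal.ofReal V) {g : X → ℝ} (hg : IntegrableOn g Q μ)
    {a : ℝ} (hg2 : IntegrableOn (fun y => (g y - a) ^ 2) Q μ) :
    (a - V⁻¹ * ∫ y in Q, g y ∂μ) ^ 2 ≤ V⁻¹ * ∫ y in Q, (g y - a) ^ 2 ∂μ := by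
  have hfin : IsFiniteMeasure (μ.restrict Q) := ⟨by simp [hQ]⟩
  have hreal : μ.real Q = V := by rw [measureReal_def, hQ, ENNReal.toReal_ofReal hV.le]
  set c := V⁻¹ * ∫ y in Q, g y ∂μ - a with hc
  -- Nonnegativity of the variance: `a + c` is the mean of `g`, and expanding the square leaves `∫
  -- (g - a)² - c²V ≥ 0`.
  have h0 : 0 ≤ ∫ y in Q, (g y - a - c) ^ 2 ∂μ := integral_nonneg fun y => sq_nonneg _
  have hga : IntegrableOn (fun y => g y - a) Q μ := hg.sub (integrable_const a)
  have h1 : ∫ y in Q, (g y - a - c) ^ 2 ∂μ =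
      (∫ y in Q, (g y - a) ^ 2 ∂μ) - 2 * c * (∫ y in Q, (g y - a) ∂μ) + c ^ 2 * V := by
    have e : ∀ y, (g y - a - c) ^ 2 = (g y - a) ^ 2 - 2 * c * (g y - a) + c ^ 2 := fun y => by ring
    simp_rw [e]
    have hsub : IntegrableOn (fun y => (g y - a) ^ 2 - 2 * c * (g y - a)) Q μ :=
      hg2.sub (hga.const_mul _)
    rw [integral_add hsub (integrable_const _),
      integral_sub hg2 (hga.const_mul _), integral_const_mul, integral_const, smul_eq_mul,
      measureReal_restrict_apply_univ, hreal, mul_comm V]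
  have h2 : ∫ y in Q, (g y - a) ∂μ = V * c := by
    rw [integral_sub hg (integrable_const _), integral_const, smul_eq_mul,
      measureReal_restrict_apply_univ, hreal, hc]
    field_simp
  rw [h1, h2] at h0
  have h3 : (a - V⁻¹ * ∫ y in Q, g y ∂μ) ^ 2 = c ^ 2 := by rw [hc]; ring
  rw [h3, inv_mul_eq_div, le_div_iff₀ hV]
  linarith

theorem sq_sub_eq_fracDiff (g : Euc d → ℝ) (x y : Euc d) :
    (g y - g x) ^ 2 = ‖x - y‖ ^ ((d : ℝ) + 2 * s) * fracDiff s g (x, y) ^ 2 := by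
  by_cases h : x = y
  · simp [h, fracDiff]
  · have h' : 0 < ‖x - y‖ := norm_pos_iff.2 (sub_ne_zero.2 h)
    have hp : ‖x - y‖ ^ ((d : ℝ) + 2 * s) = (‖x - y‖ ^ ((d : ℝ) / 2 + s)) ^ 2 := by
      rw [← Real.rpow_mul_natCast (norm_nonneg _)]
      congr 1
      push_cast
      ring
    have h'' : ‖x - y‖ ^ ((d : ℝ) / 2 + s) ≠ 0 := (Real.rpow_pos_of_pos h' _).ne'
    rw [hp, fracDiff, div_pow]
    field_simp

/-- Fractional Poincaré inequality on the cells of a grid. -/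
theorem integral_sq_sub_cellAverage_le (hs : 0 ≤ s) {δ : ℝ} (hδ : 0 < δ) (R : ℝ)
    (v : fracSobolev d s) :
    ∫ x in Metric.closedBall (0 : Euc d) R, (toL2 v - cellAverage hδ R (toL2 v)) x ^ 2 ≤
      (δ ^ d)⁻¹ * (d * δ) ^ ((d : ℝ) + 2 * s) * ‖diffQuot v‖ ^ 2 := by
  set C := (δ ^ d)⁻¹ * (d * δ) ^ ((d : ℝ) + 2 * s) with hC
  have hC0 : 0 ≤ C := by positivity
  have hD : Integrable (fun p : Euc d × Euc d => diffQuot v p ^ 2) :=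
    (Lp.memLp (diffQuot v)).integrable_sq
  have hw : MemLp (toL2 v : Euc d → ℝ) 2 volume := Lp.memLp (toL2 v)
  have hsec : ∀ᵐ x : Euc d, ∀ᵐ y : Euc d, diffQuot v (x, y) = fracDiff s (toL2 v) (x, y) :=
    Measure.ae_ae_of_ae_prod (diffQuot_ae v)
  have hpt : ∀ᵐ x : Euc d, ‖x‖ ≤ R →
      (toL2 v - cellAverage hδ R (toL2 v)) x ^ 2 ≤ C * ∫ y, diffQuot v (x, y) ^ 2 := by
    filter_upwards [Lp.coeFn_sub (toL2 v) (cellAverage hδ R (toL2 v)),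
      cellAverage_ae hδ R (toL2 v), hsec, hD.prod_right_ae] with x hx1 hx2 hx3 hx4 hxR
    set Q := gridCell δ (cellIndex δ x) with hQ
    have hQm : MeasurableSet Q := measurableSet_gridCell _ _
    have hxQ : x ∈ Q := (mem_gridCell_iff hδ).2 rfl
    have hQfin : IsFiniteMeasure (volume.restrict Q) :=
      ⟨by simpa using (volume_gridCell_ne_top hδ _).lt_top⟩
    have hwQ : MemLp (toL2 v : Euc d → ℝ) 2 (volume.restrict Q) := hw.restrict Q
    rw [hx1, Pi.sub_apply, hx2 hxR]
    refine (sq_sub_average_le (pow_pos hδ d) (volume_gridCell hδ _)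
      (hwQ.integrable one_le_two) (hwQ.sub (memLp_const _)).integrable_sq).trans ?_
    rw [hC, mul_assoc]
    refine mul_le_mul_of_nonneg_left ?_ (by positivity)
    calc ∫ y in Q, (toL2 v y - toL2 v x) ^ 2
        ≤ ∫ y in Q, (d * δ) ^ ((d : ℝ) + 2 * s) * diffQuot v (x, y) ^ 2 := by
          refine setIntegral_mono_on_ae (hwQ.sub (memLp_const _)).integrable_sq
            (hx4.integrableOn.const_mul _) hQm ?_
          filter_upwards [hx3] with y hy hyQ
          rw [hy, sq_sub_eq_fracDiff]
          refine mul_le_mul_of_nonneg_right ?_ (sq_nonneg _)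
          exact Real.rpow_le_rpow (norm_nonneg _) (norm_sub_le_of_mem_gridCell hxQ hyQ)
            (by positivity)
      _ = (d * δ) ^ ((d : ℝ) + 2 * s) * ∫ y in Q, diffQuot v (x, y) ^ 2 := integral_const_mul _ _
      _ ≤ (d * δ) ^ ((d : ℝ) + 2 * s) * ∫ y, diffQuot v (x, y) ^ 2 :=
          mul_le_mul_of_nonneg_left (setIntegral_le_integral hx4
            (Eventually.of_forall fun y => sq_nonneg _)) (by positivity)
  have hDx : Integrable (fun x : Euc d => C * ∫ y, diffQuot v (x, y) ^ 2) :=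
    hD.integral_prod_left.const_mul C
  calc ∫ x in Metric.closedBall (0 : Euc d) R, (toL2 v - cellAverage hδ R (toL2 v)) x ^ 2
      ≤ ∫ x in Metric.closedBall (0 : Euc d) R, C * ∫ y, diffQuot v (x, y) ^ 2 := by
        refine setIntegral_mono_on_ae (Lp.memLp _).integrable_sq.integrableOn hDx.integrableOn
          Metric.isClosed_closedBall.measurableSet ?_
        filter_upwards [hpt] with x hx hxR
        exact hx (by simpa using hxR)
    _ ≤ ∫ x, C * ∫ y, diffQuot v (x, y) ^ 2 :=
        setIntegral_le_integral hDx (Eventually.of_forall fun x =>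
          mul_nonneg hC0 (integral_nonneg fun y => sq_nonneg _))
    _ = C * ‖diffQuot v‖ ^ 2 := by
        rw [integral_const_mul, ← integral_mul_self_L2]
        congr 1
        refine (integral_prod (fun p : Euc d × Euc d => diffQuot v p ^ 2) hD).symm.trans ?_
        simp only [pow_two]
        rfl

/-- The powers `δ^{-d}` and `δ^d` cancel and leave a multiple of `δ^{2s}`; this is where positive
smoothness provides compactness. -/
theorem tendsto_poincare_constant (d : ℕ) (hs : 0 < s) :
    Tendsto (fun δ : ℝ => (δ ^ d)⁻¹ * (d * δ) ^ ((d : ℝ) + 2 * s)) (𝓝[>] 0) (𝓝 0) := by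
  have h : Tendsto (fun δ : ℝ => (d : ℝ) ^ ((d : ℝ) + 2 * s) * δ ^ (2 * s)) (𝓝[>] 0) (𝓝 0) := by
    have h1 : Tendsto (fun δ : ℝ => δ ^ (2 * s)) (𝓝 0) (𝓝 (0 ^ (2 * s))) :=
      (Real.continuousAt_rpow_const 0 (2 * s) (Or.inr (by positivity))).tendsto
    rw [Real.zero_rpow (by positivity)] at h1
    simpa using (h1.mono_left nhdsWithin_le_nhds).const_mul ((d : ℝ) ^ ((d : ℝ) + 2 * s))
  refine h.congr' ?_
  filter_upwards [self_mem_nhdsWithin] with δ hδ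
  have hδ : 0 < δ := hδ
  rw [Real.mul_rpow (Nat.cast_nonneg d) hδ.le, Real.rpow_add hδ, Real.rpow_natCast]
  field_simp

/-- Uniformly bounded functionals on `L²` of a ball that converge to zero pointwise converge to
zero uniformly on bounded sets of `H^s`. -/
theorem eventually_abs_le_mul_norm (hs : 0 < s) {ι : Type*} {l : Filter ι}
    {φ : ι → L2 d →ₗ[ℝ] ℝ} {M R : ℝ} (hM : 0 ≤ M)
    (hφ : ∀ i w, |φ i w| ≤ M * √(∫ x in Metric.closedBall (0 : Euc d) R, w x ^ 2))
    (hlim : ∀ w, Tendsto (fun i => φ i w) l (𝓝 0)) {η : ℝ} (hη : 0 < η) :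
    ∀ᶠ i in l, ∀ v : fracSobolev d s, |φ i (toL2 v)| ≤ η * ‖v‖ := by
  -- The mesh `δ` is fixed first, independently of `i`, so that replacing `v` by its cell averages
  -- costs at most `(η/2)‖v‖`. What remains involves finitely many fixed cell indicators, on which
  -- pointwise convergence suffices.
  have hsq := ((tendsto_poincare_constant d hs).sqrt.const_mul M)
  rw [Real.sqrt_zero, mul_zero] at hsq
  obtain ⟨δ, hδη, hδ⟩ := ((hsq.eventually (gt_mem_nhds (half_pos hη))).and
    self_mem_nhdsWithin).exists
  have hδ : 0 < δ := hδ
  set C := (δ ^ d)⁻¹ * (d * δ) ^ ((d : ℝ) + 2 * s) with hC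
  have hC0 : 0 ≤ C := by positivity
  set a : (Fin d → ℤ) → ℝ := fun k => (δ ^ d)⁻¹ * ‖cellIndicator hδ k‖ with ha
  have hsum : Tendsto (fun i => ∑ k ∈ cellIndices d δ R, a k * |φ i (cellIndicator hδ k)|) l
      (𝓝 0) := by
    have := tendsto_finsetSum (cellIndices d δ R) fun k _ =>
      ((hlim (cellIndicator hδ k)).abs.const_mul (a k))
    simpa using this
  filter_upwards [hsum.eventually (gt_mem_nhds (half_pos hη))] with i hi v
  set P := cellAverage hδ R (toL2 v) with hP
  have h1 : |φ i (toL2 v - P)| ≤ η / 2 * ‖v‖ := by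
    refine (hφ i _).trans ?_
    have h2 := (integral_sq_sub_cellAverage_le hs.le hδ R v).trans
      (mul_le_mul_of_nonneg_left (pow_le_pow_left₀ (norm_nonneg _) (norm_diffQuot_le v) 2) hC0)
    have h3 := Real.sqrt_le_sqrt h2
    rw [Real.sqrt_mul hC0, Real.sqrt_sq (norm_nonneg _)] at h3
    calc _ ≤ M * (√C * ‖v‖) := mul_le_mul_of_nonneg_left h3 hM
      _ = (M * √C) * ‖v‖ := by ring
      _ ≤ η / 2 * ‖v‖ := mul_le_mul_of_nonneg_right hδη.le (norm_nonneg _)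
  have h2 : |φ i P| ≤ η / 2 * ‖v‖ := by
    rw [hP, cellAverage, map_sum]
    refine (Finset.abs_sum_le_sum_abs _ _).trans ?_
    refine le_trans ?_ (mul_le_mul_of_nonneg_right hi.le (norm_nonneg v))
    rw [Finset.sum_mul]
    refine Finset.sum_le_sum fun k _ => ?_
    have h3 : |∫ y in gridCell δ k, toL2 v y| ≤ ‖cellIndicator hδ k‖ * ‖v‖ := by
      have h4 := abs_real_inner_le_norm (cellIndicator hδ k) (toL2 v)
      rw [cellIndicator, L2.inner_indicatorConstLp_one] at h4
      exact h4.trans (mul_le_mul_of_nonneg_left (norm_toL2_le v) (norm_nonneg _))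
    rw [map_smul, smul_eq_mul, abs_mul, abs_mul, abs_of_pos (by positivity : 0 < (δ ^ d)⁻¹), ha]
    calc (δ ^ d)⁻¹ * |∫ y in gridCell δ k, toL2 v y| * |φ i (cellIndicator hδ k)|
        ≤ (δ ^ d)⁻¹ * (‖cellIndicator hδ k‖ * ‖v‖) * |φ i (cellIndicator hδ k)| := by gcongr
      _ = _ := by ring
  calc |φ i (toL2 v)| = |φ i (toL2 v - P) + φ i P| := by rw [map_sub, sub_add_cancel]
    _ ≤ |φ i (toL2 v - P)| + |φ i P| := abs_add_le _ _
    _ ≤ η * ‖v‖ := by linarith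

end LocalCompactness

/-! ### Truncation in `L²` -/

section Truncation

variable {X : Type*} [MeasurableSpace X] {μ : Measure X}

theorem memLp_indicator_coe {S : Set X} (hS : MeasurableSet S) (w : Lp ℝ 2 μ) :
    MemLp (S.indicator (w : X → ℝ)) 2 μ :=
  MemLp.indicator hS (Lp.memLp w)

/-- Multiplication by the indicator of a measurable set, as a linear operator on `L²`. -/
def truncate {S : Set X} (hS : MeasurableSet S) : Lp ℝ 2 μ →ₗ[ℝ] Lp ℝ 2 μ where
  toFun w := (memLp_indicator_coe hS w).toLp _
  map_add' w w' := by
    rw [← MemLp.toLp_add]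
    refine MemLp.toLp_congr _ _ ?_
    filter_upwards [Lp.coeFn_add w w'] with x hx
    by_cases h : x ∈ S
    · simp only [Pi.add_apply, Set.indicator_of_mem h]
      exact hx
    · simp [h]
  map_smul' c w := by
    rw [RingHom.id_apply, ← MemLp.toLp_const_smul]
    refine MemLp.toLp_congr _ _ ?_
    filter_upwards [Lp.coeFn_smul c w] with x hx
    by_cases h : x ∈ S
    · simp only [Pi.smul_apply, Set.indicator_of_mem h]
      exact hx
    · simp [h]

theorem truncate_ae {S : Set X} (hS : MeasurableSet S) (w : Lp ℝ 2 μ) :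
    (truncate hS w : X → ℝ) =ᵐ[μ] S.indicator (w : X → ℝ) := by
  have h : truncate hS w = (memLp_indicator_coe hS w).toLp _ := rfl
  rw [h]
  exact MemLp.coeFn_toLp (memLp_indicator_coe hS w)

theorem norm_sq_truncate {S : Set X} (hS : MeasurableSet S) (w : Lp ℝ 2 μ) :
    ‖truncate hS w‖ ^ 2 = ∫ x in S, w x ^ 2 ∂μ := by
  rw [← integral_mul_self_L2, ← integral_indicator hS]
  refine integral_congr_ae ?_
  filter_upwards [truncate_ae hS w] with x hx
  by_cases h : x ∈ S <;> simp [h, hx, pow_two]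

/-- Truncations to sets exhausting the support converge in `L²`. -/
theorem exists_norm_sub_truncate_lt {S : ℕ → Set X} (hS : ∀ n, MeasurableSet (S n))
    (w : Lp ℝ 2 μ) (hw : ∀ᵐ x ∂μ, w x = 0 ∨ ∀ᶠ n in atTop, x ∈ S n) {e : ℝ} (he : 0 < e) :
    ∃ n, ‖w - truncate (hS n) w‖ < e := by
  have hsq : Integrable (fun x => w x ^ 2) μ := (Lp.memLp w).integrable_sq
  have hlim : Tendsto (fun n => ∫ x, (S n)ᶜ.indicator (fun x => w x ^ 2) x ∂μ) atTop
      (𝓝 (∫ _, (0 : ℝ) ∂μ)) := by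
    refine tendsto_integral_of_dominated_convergence (fun x => w x ^ 2)
      (fun n => (hsq.indicator (hS n).compl).aestronglyMeasurable) hsq
      (fun n => Eventually.of_forall fun x => ?_) ?_
    · rw [Real.norm_eq_abs, abs_of_nonneg (Set.indicator_nonneg (fun x _ => sq_nonneg _) x)]
      exact Set.indicator_le_self' (fun x _ => sq_nonneg _) x
    · filter_upwards [hw] with x hx
      refine tendsto_const_nhds.congr' ?_
      rcases hx with hx | hx
      · exact Eventually.of_forall fun n => by by_cases h : x ∈ S n <;> simp [h, hx]
      · filter_upwards [hx] with n hn
        simp [hn]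
  rw [integral_zero] at hlim
  obtain ⟨n, hn⟩ := (hlim.eventually (gt_mem_nhds (pow_pos he 2))).exists
  refine ⟨n, lt_of_pow_lt_pow_left₀ 2 he.le (lt_of_le_of_lt (le_of_eq ?_) hn)⟩
  rw [← integral_mul_self_L2]
  refine integral_congr_ae ?_
  filter_upwards [truncate_ae (hS n) w, Lp.coeFn_sub w (truncate (hS n) w)] with x h1 h2
  rw [h2, Pi.sub_apply, h1]
  by_cases h : x ∈ S n <;> simp [h, pow_two]

theorem weightedForm_sub_weight {a b : X → ℝ} {M : ℝ} (ha : AEMeasurable a μ)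
    (hb : AEMeasurable b μ) (haM : ∀ x, |a x| ≤ M) (hbM : ∀ x, |b x| ≤ M) (f g : Lp ℝ 2 μ) :
    weightedForm (fun x => a x - b x) f g = weightedForm a f g - weightedForm b f g := by
  rw [weightedForm, weightedForm, weightedForm, ← integral_sub
    (integrable_weighted ha haM (integrable_mul_L2 f g))
    (integrable_weighted hb hbM (integrable_mul_L2 f g))]
  simp only [sub_mul]

theorem weightedForm_sub_left {a : X → ℝ} {M : ℝ} (ha : AEMeasurable a μ) (hb : ∀ x, |a x| ≤ M)
    (f f' g : Lp ℝ 2 μ) :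
    weightedForm a (f - f') g = weightedForm a f g - weightedForm a f' g := by
  rw [eq_sub_iff_add_eq, ← weightedForm_add_left ha hb, sub_add_cancel]

theorem weightedForm_congr {a : X → ℝ} {f g f' g' : Lp ℝ 2 μ}
    (h : ∀ᵐ x ∂μ, f x * g x = f' x * g' x) : weightedForm a f g = weightedForm a f' g' := by
  refine integral_congr_ae ?_
  filter_upwards [h] with x hx
  rw [hx]

end Truncation

/-! ### The difference quotient away from the diagonal -/

section TruncatedDifference

variable {d : ℕ} {s : ℝ}

/-- Pairs of points in a ball at distance at least `ρ`. -/
def separatedPairs (d : ℕ) (R ρ : ℝ) : Set (Euc d × Euc d) :=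
  {p | ‖p.1‖ ≤ R ∧ ‖p.2‖ ≤ R ∧ ρ ≤ ‖p.1 - p.2‖}

theorem measurableSet_separatedPairs (R ρ : ℝ) : MeasurableSet (separatedPairs d R ρ) := by
  exact (measurableSet_le measurable_fst.norm measurable_const).inter
    ((measurableSet_le measurable_snd.norm measurable_const).inter
      (measurableSet_le measurable_const (measurable_fst.sub measurable_snd).norm))

theorem aemeasurable_fracDiff {w : Euc d → ℝ} (hw : AEMeasurable w) :
    AEMeasurable (fracDiff s w) (volume : Measure (Euc d × Euc d)) := by
  have h1 : AEMeasurable (fun p : Euc d × Euc d => w p.1)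
      (volume : Measure (Euc d × Euc d)) :=
    hw.comp_quasiMeasurePreserving Measure.quasiMeasurePreserving_fst
  have h2 : AEMeasurable (fun p : Euc d × Euc d => w p.2)
      (volume : Measure (Euc d × Euc d)) :=
    hw.comp_quasiMeasurePreserving Measure.quasiMeasurePreserving_snd
  exact (h2.sub h1).div (by fun_prop)

/-- On separated pairs the kernel is at most a power of `1/ρ`, so no regularity of `w` is needed.
The factor `4` comes from `(a - b)² ≤ 2(a² + b²)` and from two equal integrals over the product of
the ball with itself. -/
theorem truncated_fracDiff_bound {R ρ : ℝ} (hs : 0 ≤ s) (hρ : 0 < ρ) (w : L2 d) :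
    MemLp ((separatedPairs d R ρ).indicator (fracDiff s w)) 2
      (volume : Measure (Euc d × Euc d)) ∧
    ∫ p : Euc d × Euc d, (separatedPairs d R ρ).indicator (fracDiff s w) p ^ 2 ≤
      4 * ((ρ ^ ((d : ℝ) / 2 + s))⁻¹) ^ 2 * volume.real (Metric.closedBall (0 : Euc d) R) *
        ∫ x in Metric.closedBall (0 : Euc d) R, w x ^ 2 := by
  set B := Metric.closedBall (0 : Euc d) R with hB
  set c := (ρ ^ ((d : ℝ) / 2 + s))⁻¹ with hc
  have hc0 : 0 ≤ c := by positivity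
  have hBm : MeasurableSet B := Metric.isClosed_closedBall.measurableSet
  have hone : Integrable (B.indicator fun _ => (1 : ℝ)) (volume : Measure (Euc d)) :=
    (integrable_indicator_iff hBm).2 (integrableOn_const (isCompact_closedBall _ _).measure_ne_top)
  have hw2 : Integrable (B.indicator fun x => w x ^ 2) (volume : Measure (Euc d)) :=
    (Lp.memLp w).integrable_sq.indicator hBm
  have i1 : Integrable (fun p : Euc d × Euc d =>
      B.indicator (fun _ => (1 : ℝ)) p.1 * B.indicator (fun x => w x ^ 2) p.2)
      (volume : Measure (Euc d × Euc d)) := hone.mul_prod hw2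
  have i2 : Integrable (fun p : Euc d × Euc d =>
      B.indicator (fun x => w x ^ 2) p.1 * B.indicator (fun _ => (1 : ℝ)) p.2)
      (volume : Measure (Euc d × Euc d)) := hw2.mul_prod hone
  have i3 := (i1.add i2).const_mul (2 * c ^ 2)
  have hle : ∀ p : Euc d × Euc d, (separatedPairs d R ρ).indicator (fracDiff s w) p ^ 2 ≤
      2 * c ^ 2 * (B.indicator (fun _ => (1 : ℝ)) p.1 * B.indicator (fun x => w x ^ 2) p.2 +
        B.indicator (fun x => w x ^ 2) p.1 * B.indicator (fun _ => (1 : ℝ)) p.2) := by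
    intro p
    by_cases hp : p ∈ separatedPairs d R ρ
    · have hp' := hp
      obtain ⟨h1, h2, h3⟩ := hp'
      have h1' : p.1 ∈ B := by simpa [hB] using h1
      have h2' : p.2 ∈ B := by simpa [hB] using h2
      simp only [Set.indicator_of_mem hp, Set.indicator_of_mem h1', Set.indicator_of_mem h2']
      have h4 : (‖p.1 - p.2‖ ^ ((d : ℝ) / 2 + s))⁻¹ ≤ c :=
        inv_anti₀ (by positivity) (Real.rpow_le_rpow hρ.le h3 (by positivity))
      have h5 : 0 ≤ (‖p.1 - p.2‖ ^ ((d : ℝ) / 2 + s))⁻¹ := by positivity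
      rw [fracDiff, div_eq_mul_inv, mul_pow]
      calc (w p.2 - w p.1) ^ 2 * ((‖p.1 - p.2‖ ^ ((d : ℝ) / 2 + s))⁻¹) ^ 2
          ≤ (2 * (w p.2 ^ 2 + w p.1 ^ 2)) * c ^ 2 := by
            refine mul_le_mul ?_ (pow_le_pow_left₀ h5 h4 2) (by positivity) (by positivity)
            nlinarith [sq_nonneg (w p.2 + w p.1)]
        _ = _ := by ring
    · rw [Set.indicator_of_notMem hp]
      have h1 : ∀ x, 0 ≤ B.indicator (fun _ => (1 : ℝ)) x :=
        fun x => Set.indicator_nonneg (fun _ _ => zero_le_one) x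
      have h2 : ∀ x, 0 ≤ B.indicator (fun x => w x ^ 2) x :=
        fun x => Set.indicator_nonneg (fun _ _ => sq_nonneg _) x
      have := mul_nonneg (h1 p.1) (h2 p.2)
      have := mul_nonneg (h2 p.1) (h1 p.2)
      rw [zero_pow two_ne_zero]
      positivity
  have hmeas : AEStronglyMeasurable ((separatedPairs d R ρ).indicator (fracDiff s w))
      (volume : Measure (Euc d × Euc d)) :=
    ((aemeasurable_fracDiff (Lp.aestronglyMeasurable w).aemeasurable).indicator
      (measurableSet_separatedPairs R ρ)).aestronglyMeasurable
  have hint : Integrable (fun p => (separatedPairs d R ρ).indicator (fracDiff s w) p ^ 2)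
      (volume : Measure (Euc d × Euc d)) := by
    refine i3.mono' (hmeas.pow 2) (Eventually.of_forall fun p => ?_)
    rw [Real.norm_of_nonneg (sq_nonneg _)]
    exact hle p
  refine ⟨(memLp_two_iff_integrable_sq hmeas).2 hint, ?_⟩
  refine (integral_mono hint i3 hle).trans (le_of_eq ?_)
  have e1 : ∫ p : Euc d × Euc d,
      B.indicator (fun _ => (1 : ℝ)) p.1 * B.indicator (fun x => w x ^ 2) p.2 =
        volume.real B * ∫ x in B, w x ^ 2 := by
    refine (integral_prod_mul (μ := (volume : Measure (Euc d)))
      (ν := (volume : Measure (Euc d))) _ _).trans ?_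
    rw [integral_indicator hBm, integral_indicator hBm]
    simp
  have e2 : ∫ p : Euc d × Euc d,
      B.indicator (fun x => w x ^ 2) p.1 * B.indicator (fun _ => (1 : ℝ)) p.2 =
        volume.real B * ∫ x in B, w x ^ 2 := by
    refine (integral_prod_mul (μ := (volume : Measure (Euc d)))
      (ν := (volume : Measure (Euc d))) _ _).trans ?_
    rw [integral_indicator hBm, integral_indicator hBm]
    simp [mul_comm]
  rw [integral_const_mul]
  have e3 := integral_add i1 i2
  rw [e1, e2] at e3
  refine (congrArg (fun t => 2 * c ^ 2 * t) e3).trans ?_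
  ring

/-- The difference quotient, truncated to separated pairs, as a linear map on all of `L²`. -/
def truncatedDiff (R : ℝ) {ρ : ℝ} (hs : 0 ≤ s) (hρ : 0 < ρ) : L2 d →ₗ[ℝ] L2Pair d where
  toFun w := (truncated_fracDiff_bound (R := R) hs hρ w).1.toLp _
  map_add' w w' := by
    rw [← MemLp.toLp_add]
    refine MemLp.toLp_congr _ _ ?_
    filter_upwards [fracDiff_ae_congr s (Lp.coeFn_add w w')] with p hp
    by_cases h : p ∈ separatedPairs d R ρ
    · rw [Pi.add_apply, Set.indicator_of_mem h, Set.indicator_of_mem h, Set.indicator_of_mem h, hp]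
      simp only [Pi.add_apply, fracDiff]
      ring
    · simp [h]
  map_smul' c w := by
    rw [RingHom.id_apply, ← MemLp.toLp_const_smul]
    refine MemLp.toLp_congr _ _ ?_
    filter_upwards [fracDiff_ae_congr s (Lp.coeFn_smul c w)] with p hp
    by_cases h : p ∈ separatedPairs d R ρ
    · rw [Pi.smul_apply, Set.indicator_of_mem h, Set.indicator_of_mem h, hp]
      simp only [Pi.smul_apply, fracDiff, smul_eq_mul]
      ring
    · simp [h]

theorem truncatedDiff_ae (R : ℝ) {ρ : ℝ} (hs : 0 ≤ s) (hρ : 0 < ρ) (w : L2 d) :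
    (truncatedDiff R hs hρ w : Euc d × Euc d → ℝ) =ᵐ[volume]
      (separatedPairs d R ρ).indicator (fracDiff s w) :=
  MemLp.coeFn_toLp (truncated_fracDiff_bound hs hρ w).1

theorem exists_norm_truncatedDiff_le (R : ℝ) {ρ : ℝ} (hs : 0 ≤ s) (hρ : 0 < ρ) :
    ∃ C : ℝ, 0 ≤ C ∧ ∀ w : L2 d, ‖truncatedDiff R hs hρ w‖ ≤
      C * √(∫ x in Metric.closedBall (0 : Euc d) R, w x ^ 2) := by
  set A := 4 * ((ρ ^ ((d : ℝ) / 2 + s))⁻¹) ^ 2 *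
    volume.real (Metric.closedBall (0 : Euc d) R) with hA
  have hA0 : 0 ≤ A := by positivity
  refine ⟨√A, Real.sqrt_nonneg _, fun w => ?_⟩
  rw [← Real.sqrt_mul hA0]
  refine Real.le_sqrt_of_sq_le ?_
  rw [← integral_mul_self_L2]
  refine le_trans (le_of_eq ?_) (truncated_fracDiff_bound (R := R) hs hρ w).2
  refine integral_congr_ae ?_
  filter_upwards [truncatedDiff_ae R hs hρ w] with p hp
  rw [hp, pow_two]

end TruncatedDifference

/-! ### Convergence of solutions under weak-* convergence of coefficients -/

section Convergence

variable {d : ℕ} {s : ℝ} {ι : Type*} {l : Filter ι}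

/-- `a i → a₀` weakly-* in `L^∞`. -/
def TendstoWeakStar {X : Type*} [MeasurableSpace X] (μ : Measure X) (a : ι → X → ℝ)
    (l : Filter ι) (a₀ : X → ℝ) : Prop :=
  ∀ G : X → ℝ, Integrable G μ →
    Tendsto (fun i => ∫ x, a i x * G x ∂μ) l (𝓝 (∫ x, a₀ x * G x ∂μ))

section

variable {X : Type*} [MeasurableSpace X] {μ : Measure X} {a : ι → X → ℝ} {a₀ : X → ℝ} {M : ℝ}

/-- For fixed `w` the product `g · T w` is integrable, so weak-* convergence sends the functional at
`w` to zero; the bound on `T` lets local compactness make this uniform in `v`. The operator `T` will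
be truncation to a ball or the truncated difference quotient. -/
theorem eventually_weightedForm_comp_le (hs : 0 < s) (ha : ∀ i, AEMeasurable (a i) μ)
    (ha₀ : AEMeasurable a₀ μ) (hM : ∀ i x, |a i x| ≤ M) (hM₀ : ∀ x, |a₀ x| ≤ M) (hM0 : 0 ≤ M)
    (hlim : TendstoWeakStar μ a l a₀) {T : L2 d →ₗ[ℝ] Lp ℝ 2 μ} {C R : ℝ} (hC : 0 ≤ C)
    (hT : ∀ w, ‖T w‖ ≤ C * √(∫ x in Metric.closedBall (0 : Euc d) R, w x ^ 2))
    (g : Lp ℝ 2 μ) {η : ℝ} (hη : 0 < η) :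
    ∀ᶠ i in l, ∀ v : fracSobolev d s,
      |weightedForm (fun x => a i x - a₀ x) g (T (toL2 v))| ≤ η * ‖v‖ := by
  have hb : ∀ i x, |a i x - a₀ x| ≤ 2 * M := fun i x =>
    (abs_sub _ _).trans (by linarith [hM i x, hM₀ x])
  have hab : ∀ i, AEMeasurable (fun x => a i x - a₀ x) _ := fun i => (ha i).sub ha₀
  let φ : ι → L2 d →ₗ[ℝ] ℝ := fun i =>
    (weightedFormCLM (hab i) (hb i) (by positivity) g).toLinearMap.comp T
  have hφ : ∀ i w, φ i w = weightedForm (fun x => a i x - a₀ x) g (T w) := fun i w => rfl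
  refine eventually_abs_le_mul_norm (φ := φ) (M := 2 * M * ‖g‖ * C) (R := R) hs (by positivity)
    (fun i w => ?_) (fun w => ?_) hη
  · rw [hφ, mul_assoc (2 * M * ‖g‖)]
    exact (abs_weightedForm_le (hb i) (by positivity) _ _).trans
      (mul_le_mul_of_nonneg_left (hT w) (by positivity))
  · have h := (hlim _ (integrable_mul_L2 g (T w))).sub_const
      (∫ x, a₀ x * (g x * T w x) ∂μ)
    rw [sub_self] at h
    refine h.congr fun i => ?_
    rw [hφ, weightedForm_sub_weight (ha i) ha₀ (hM i) hM₀, weightedForm, weightedForm]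

end

/-- Compactness holds only locally, so `g` is first cut to a large ball. The coefficient difference
is at most `2M`, so a tail of norm below `η / (2(2M + 1))` contributes at most half of the bound. -/
theorem eventually_weightedForm_toL2_le (hs : 0 < s) {a : ι → Euc d → ℝ} {a₀ : Euc d → ℝ} {M : ℝ}
    (ha : ∀ i, AEMeasurable (a i)) (ha₀ : AEMeasurable a₀) (hM : ∀ i x, |a i x| ≤ M)
    (hM₀ : ∀ x, |a₀ x| ≤ M) (hlim : TendstoWeakStar volume a l a₀) (g : L2 d)
    {η : ℝ} (hη : 0 < η) :
    ∀ᶠ i in l, ∀ v : fracSobolev d s,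
      |weightedForm (fun x => a i x - a₀ x) g (toL2 v)| ≤ η * ‖v‖ := by
  have hM0 : 0 ≤ M := (abs_nonneg _).trans (hM₀ 0)
  have hb : ∀ i x, |a i x - a₀ x| ≤ 2 * M := fun i x =>
    (abs_sub _ _).trans (by linarith [hM i x, hM₀ x])
  have hab : ∀ i, AEMeasurable (fun x => a i x - a₀ x) _ := fun i => (ha i).sub ha₀
  have hB : ∀ n : ℕ, MeasurableSet (Metric.closedBall (0 : Euc d) n) :=
    fun n => Metric.isClosed_closedBall.measurableSet
  obtain ⟨n, hn⟩ := exists_norm_sub_truncate_lt hB g (Eventually.of_forall fun x => Or.inr (by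
    obtain ⟨N, hN⟩ := exists_nat_ge ‖x‖
    filter_upwards [eventually_ge_atTop N] with k hk
    simpa using hN.trans (Nat.cast_le.2 hk))) (show 0 < η / (2 * (2 * M + 1)) by positivity)
  filter_upwards [eventually_weightedForm_comp_le (T := truncate (hB n)) (C := 1) (R := n) hs
    ha ha₀ hM hM₀ hM0 hlim zero_le_one (fun w => by
      rw [one_mul, ← norm_sq_truncate (hB n), Real.sqrt_sq (norm_nonneg _)])
    (truncate (hB n) g) (half_pos hη)] with i hi v
  have e1 : weightedForm (fun x => a i x - a₀ x) (truncate (hB n) g) (truncate (hB n) (toL2 v)) =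
      weightedForm (fun x => a i x - a₀ x) (truncate (hB n) g) (toL2 v) := by
    refine weightedForm_congr ?_
    filter_upwards [truncate_ae (hB n) g, truncate_ae (hB n) (toL2 v)] with x h1 h2
    by_cases h : x ∈ Metric.closedBall (0 : Euc d) n <;> simp [h1, h2, h]
  have h1 := hi v
  rw [e1] at h1
  have h2 := abs_weightedForm_le (hb i) (by positivity) (g - truncate (hB n) g) (toL2 v)
  have h3 : 2 * M * ‖g - truncate (hB n) g‖ ≤ η / 2 := by
    calc 2 * M * ‖g - truncate (hB n) g‖ ≤ 2 * M * (η / (2 * (2 * M + 1))) := by gcongr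
      _ ≤ η / 2 := by
        rw [mul_div_assoc', div_le_div_iff₀ (by positivity) (by positivity)]
        nlinarith
  have h4 : 2 * M * ‖g - truncate (hB n) g‖ * ‖toL2 v‖ ≤ η / 2 * ‖v‖ :=
    mul_le_mul h3 (norm_toL2_le v) (norm_nonneg _) (by positivity)
  rw [weightedForm_sub_left (hab i) (hb i)] at h2
  have h5 := abs_sub_abs_le_abs_sub (weightedForm (fun x => a i x - a₀ x) g (toL2 v))
    (weightedForm (fun x => a i x - a₀ x) (truncate (hB n) g) (toL2 v))
  linarith

/-- Here the cut removes from `Du` a neighbourhood of the diagonal as well as infinity. It is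
applied to the fixed factor `Du`, whose discarded part is small independently of `v`; `Dv` has no
such uniform smallness. -/
theorem eventually_weightedForm_diffQuot_le (hs : 0 < s) {a : ι → Euc d × Euc d → ℝ}
    {a₀ : Euc d × Euc d → ℝ} {M : ℝ}
    (ha : ∀ i, AEMeasurable (a i)) (ha₀ : AEMeasurable a₀) (hM : ∀ i x, |a i x| ≤ M)
    (hM₀ : ∀ x, |a₀ x| ≤ M) (hlim : TendstoWeakStar volume a l a₀) (u : fracSobolev d s)
    {η : ℝ} (hη : 0 < η) :
    ∀ᶠ i in l, ∀ v : fracSobolev d s,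
      |weightedForm (fun x => a i x - a₀ x) (diffQuot u) (diffQuot v)| ≤ η * ‖v‖ := by
  have hM0 : 0 ≤ M := (abs_nonneg _).trans (hM₀ 0)
  have hb : ∀ i x, |a i x - a₀ x| ≤ 2 * M := fun i x =>
    (abs_sub _ _).trans (by linarith [hM i x, hM₀ x])
  have hab : ∀ i, AEMeasurable (fun x => a i x - a₀ x) _ := fun i => (ha i).sub ha₀
  let S : ℕ → Set (Euc d × Euc d) := fun n => separatedPairs d n (1 / ((n : ℝ) + 1))
  have hS : ∀ n, MeasurableSet (S n) := fun n => measurableSet_separatedPairs _ _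
  set g := diffQuot u with hg
  obtain ⟨n, hn⟩ := exists_norm_sub_truncate_lt hS g (by
    filter_upwards [diffQuot_ae u] with p hp
    -- The quotient vanishes on the diagonal because its numerator does, and every other pair
    -- eventually lies in `S n`.
    by_cases h : p.1 = p.2
    · left
      rw [hg, hp, fracDiff, h]
      simp
    · right
      obtain ⟨N₁, h₁⟩ := exists_nat_ge ‖p.1‖
      obtain ⟨N₂, h₂⟩ := exists_nat_ge ‖p.2‖
      obtain ⟨N₃, h₃⟩ := exists_nat_one_div_lt (norm_pos_iff.2 (sub_ne_zero.2 h))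
      filter_upwards [eventually_ge_atTop N₁, eventually_ge_atTop N₂, eventually_ge_atTop N₃]
        with k k₁ k₂ k₃
      refine ⟨h₁.trans (Nat.cast_le.2 k₁), h₂.trans (Nat.cast_le.2 k₂), le_trans ?_ h₃.le⟩
      exact one_div_le_one_div_of_le (by positivity) (by exact_mod_cast Nat.succ_le_succ k₃))
    (show 0 < η / (2 * (2 * M + 1)) by positivity)
  have hρ : (0 : ℝ) < 1 / ((n : ℝ) + 1) := by positivity
  obtain ⟨C, hC, hCT⟩ := exists_norm_truncatedDiff_le (d := d) (n : ℝ) hs.le hρ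
  filter_upwards [eventually_weightedForm_comp_le hs ha ha₀ hM hM₀ hM0 hlim hC hCT
    (truncate (hS n) g) (half_pos hη)] with i hi v
  -- Since `g` is already cut to `S n`, the full quotient of `v` may replace the truncated one.
  have e1 : weightedForm (fun x => a i x - a₀ x) (truncate (hS n) g)
        (truncatedDiff (n : ℝ) hs.le hρ (toL2 v)) =
      weightedForm (fun x => a i x - a₀ x) (truncate (hS n) g) (diffQuot v) := by
    refine weightedForm_congr ?_
    filter_upwards [truncate_ae (hS n) g, truncatedDiff_ae (n : ℝ) hs.le hρ (toL2 v),
      diffQuot_ae v] with x h1 h2 h3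
    rw [h1, h2, h3]
    by_cases h : x ∈ separatedPairs d n (1 / ((n : ℝ) + 1))
    · rw [Set.indicator_of_mem h, Set.indicator_of_mem (show x ∈ S n from h)]
    · rw [Set.indicator_of_notMem h, Set.indicator_of_notMem (show x ∉ S n from h)]
      simp
  have h1 := hi v
  rw [e1] at h1
  have h2 := abs_weightedForm_le (hb i) (by positivity) (g - truncate (hS n) g) (diffQuot v)
  have h3 : 2 * M * ‖g - truncate (hS n) g‖ ≤ η / 2 := by
    calc 2 * M * ‖g - truncate (hS n) g‖ ≤ 2 * M * (η / (2 * (2 * M + 1))) := by gcongr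
      _ ≤ η / 2 := by
        rw [mul_div_assoc', div_le_div_iff₀ (by positivity) (by positivity)]
        nlinarith
  have h4 : 2 * M * ‖g - truncate (hS n) g‖ * ‖diffQuot v‖ ≤ η / 2 * ‖v‖ :=
    mul_le_mul h3 (norm_diffQuot_le v) (norm_nonneg _) (by positivity)
  rw [weightedForm_sub_left (hab i) (hb i)] at h2
  have h5 := abs_sub_abs_le_abs_sub (weightedForm (fun x => a i x - a₀ x) g (diffQuot v))
    (weightedForm (fun x => a i x - a₀ x) (truncate (hS n) g) (diffQuot v))
  linarith

/-- If coefficients and weights converge weakly-*, then weak solutions converge in `H^s`. -/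
theorem tendsto_weakSolution (hs : 0 < s) {κ : ι → Euc d × Euc d → ℝ}
    {κ₀ : Euc d × Euc d → ℝ} {w : ι → Euc d → ℝ} {w₀ : Euc d → ℝ} {c M : ℝ} (hc : 0 < c)
    (hκ : ∀ i, AEMeasurable (κ i)) (hκ₀ : AEMeasurable κ₀) (hw : ∀ i, AEMeasurable (w i))
    (hw₀ : AEMeasurable w₀) (hκc : ∀ i p, c ≤ κ i p) (hwc : ∀ i x, c ≤ w i x)
    (hκM : ∀ i p, |κ i p| ≤ M) (hκM₀ : ∀ p, |κ₀ p| ≤ M) (hwM : ∀ i x, |w i x| ≤ M)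
    (hwM₀ : ∀ x, |w₀ x| ≤ M) (hκlim : TendstoWeakStar volume κ l κ₀)
    (hwlim : TendstoWeakStar volume w l w₀) {m : ℝ} (hm : 0 < m) {f : L2 d}
    {u : ι → fracSobolev d s} {u₀ : fracSobolev d s}
    (hu : ∀ i, IsWeakSolution (κ i) (w i) m f (u i)) (hu₀ : IsWeakSolution κ₀ w₀ m f u₀) :
    Tendsto u l (𝓝 u₀) := by
  rw [Metric.tendsto_nhds]
  intro e he
  set q := c * min (1 / 2) m with hq
  have hq0 : 0 < q := by positivity
  -- The three errors enter with coefficients `1`, `m` and `1/2`, together at most `2 + m`; the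
  -- remaining factor `2` yields `‖z‖ ≤ e/2`, hence a strict inequality.
  set η := q * e / (2 * (2 + m)) with hη
  have hη0 : 0 < η := by positivity
  filter_upwards [eventually_weightedForm_toL2_le hs hw hw₀ hwM hwM₀ hwlim f hη0,
    eventually_weightedForm_toL2_le hs hw hw₀ hwM hwM₀ hwlim (toL2 u₀) hη0,
    eventually_weightedForm_diffQuot_le hs hκ hκ₀ hκM hκM₀ hκlim u₀ hη0] with i h1 h2 h3
  set z := u i - u₀ with hz
  specialize h1 z
  specialize h2 z
  specialize h3 z
  rw [weightedForm_sub_weight (hw i) hw₀ (hwM i) hwM₀] at h1 h2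
  rw [weightedForm_sub_weight (hκ i) hκ₀ (hκM i) hκM₀] at h3
  have e1 := hu i z
  have e2 := hu₀ z
  have d1 : diffQuot z = diffQuot (u i) - diffQuot u₀ := map_sub _ _ _
  have d2 : toL2 z = toL2 (u i) - toL2 u₀ :=
    (toL2CLM (d := d) (s := s)).map_sub (u i) u₀
  have c1 := le_weightedForm_self (hκ i) (hκM i) (hκc i) (diffQuot z)
  have c2 := le_weightedForm_self (hw i) (hwM i) (hwc i) (toL2 z)
  have s1 : weightedForm (κ i) (diffQuot z) (diffQuot z) =
      weightedForm (κ i) (diffQuot (u i)) (diffQuot z) -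
        weightedForm (κ i) (diffQuot u₀) (diffQuot z) := by
    conv_lhs => rw [show weightedForm (κ i) (diffQuot z) (diffQuot z) =
      weightedForm (κ i) (diffQuot (u i) - diffQuot u₀) (diffQuot z) by rw [← d1]]
    exact weightedForm_sub_left (hκ i) (hκM i) _ _ _
  have s2 : weightedForm (w i) (toL2 z) (toL2 z) =
      weightedForm (w i) (toL2 (u i)) (toL2 z) - weightedForm (w i) (toL2 u₀) (toL2 z) := by
    conv_lhs => rw [show weightedForm (w i) (toL2 z) (toL2 z) =
      weightedForm (w i) (toL2 (u i) - toL2 u₀) (toL2 z) by rw [← d2]]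
    exact weightedForm_sub_left (hw i) (hwM i) _ _ _
  have hn := norm_sq_eq_add z
  have k1 : min (1 / 2) m * (c * ‖toL2 z‖ ^ 2) ≤ m * weightedForm (w i) (toL2 z) (toL2 z) :=
    mul_le_mul (min_le_right _ _) c2 (by positivity) hm.le
  have k2 : min (1 / 2) m * (c * ‖diffQuot z‖ ^ 2) ≤
      1 / 2 * weightedForm (κ i) (diffQuot z) (diffQuot z) :=
    mul_le_mul (min_le_left _ _) c1 (by positivity) (by norm_num)
  -- Coercivity bounds the left side by the `i`-th form at `(z, z)`. The two equations tested with
  -- `z` turn that into the coefficient differences paired with `u₀` and `f` only, both fixed; the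
  -- varying `u i` has disappeared.
  have k3 : q * ‖z‖ ^ 2 ≤ (2 + m) * η * ‖z‖ := by
    have t2 := mul_le_mul_of_nonneg_left (neg_le_of_abs_le h2) hm.le
    have : q * ‖z‖ ^ 2 = min (1 / 2) m * (c * ‖toL2 z‖ ^ 2) +
        min (1 / 2) m * (c * ‖diffQuot z‖ ^ 2) := by rw [hn, hq]; ring
    have t0 : 0 ≤ η * ‖z‖ := by positivity
    rw [this]
    rw [s2] at k1
    rw [s1] at k2
    linarith [neg_le_of_abs_le h1, neg_le_of_abs_le h3]
  rw [dist_eq_norm, ← hz]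
  have k4 : (2 + m) * η = q * e / 2 := by rw [hη]; field_simp
  rw [k4] at k3
  by_contra hcon
  push Not at hcon
  have hzpos : 0 < ‖z‖ := he.trans_le hcon
  have := le_of_mul_le_mul_right (by linarith [k3, pow_two ‖z‖] :
    q * ‖z‖ * ‖z‖ ≤ q * e / 2 * ‖z‖) hzpos
  nlinarith

end Convergence

/-! ### Homogenization in the two structural cases -/

variable {d : ℕ}

theorem isAveragingCell_unitCell (d : ℕ) :
    IsAveragingCell (volume : Measure (Euc d))
      (Set.range (EuclideanSpace.basisFun (Fin d) ℝ).toBasis) (unitCell d) := by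
  refine isAveragingCell_of_basis _ isBounded_unitCell volume_unitCell ?_
  have e : gridCell (d := d) 1 0 =
      ZSpan.fundamentalDomain (EuclideanSpace.basisFun (Fin d) ℝ).toBasis := by
    ext x
    simp [ZSpan.mem_fundamentalDomain, gridCell]
  rw [← e]
  exact ae_unitCell_eq_gridCell

theorem UnitPeriodic.add_basis {h : Euc d → ℝ} (hh : UnitPeriodic h) :
    ∀ g ∈ Set.range (EuclideanSpace.basisFun (Fin d) ℝ).toBasis, ∀ z, h (z + g) = h z := by
  rintro _ ⟨i, rfl⟩ z
  simpa using hh i z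

/-- Averages over a set of unit mass preserve bounds. -/
theorem setIntegral_mem_Icc {X : Type*} [MeasurableSpace X] {μ : Measure X} {Y : Set X}
    (hY : μ Y = 1) {h : X → ℝ} (hm : AEMeasurable h μ) {c M : ℝ} (hh : ∀ x, h x ∈ Set.Icc c M) :
    ∫ x in Y, h x ∂μ ∈ Set.Icc c M := by
  have hfin : IsFiniteMeasure (μ.restrict Y) := ⟨by simp [hY]⟩
  have hconst : ∀ t : ℝ, ∫ _ in Y, t ∂μ = t := fun t => by simp [measureReal_def, hY]
  have hint : IntegrableOn h Y μ :=
    Integrable.of_mem_Icc c M hm.restrict (Eventually.of_forall hh)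
  constructor
  · calc c = ∫ _ in Y, c ∂μ := (hconst c).symm
      _ ≤ _ := integral_mono (integrable_const _) hint fun x => (hh x).1
  · calc _ ≤ ∫ _ in Y, M ∂μ := integral_mono hint (integrable_const _) fun x => (hh x).2
      _ = M := hconst M

/-- Weak-* limits produce the pair `(κ₀, ν₀)`, whereas the effective equation is normalized to
weight `1`; the two differ by the constant factor `ν₀`. -/
theorem isWeakSolution_const_mul_iff {s : ℝ} {κ : Euc d × Euc d → ℝ} {w : Euc d → ℝ} {m : ℝ}
    {f : L2 d} {u : fracSobolev d s} {t : ℝ} (ht : t ≠ 0) :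
    IsWeakSolution (fun p => t * κ p) (fun x => t * w x) m f u ↔ IsWeakSolution κ w m f u := by
  have h : ∀ {X : Type} [MeasurableSpace X] {μ : Measure X} (a : X → ℝ) (g g' : Lp ℝ 2 μ),
      weightedForm (fun x => t * a x) g g' = t * weightedForm a g g' := by
    intro X _ μ a g g'
    simp only [weightedForm, mul_assoc, integral_const_mul]
  refine forall_congr' fun v => ?_
  rw [h, h, h]
  constructor
  · intro e
    refine mul_left_cancel₀ ht ?_
    linarith
  · intro e
    linear_combination t * e

/-- The abstract convergence result asks its hypotheses of every index, and measurability and the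
equation are available only for `ε > 0`; the positive reals therefore serve as index set. -/
theorem tendsto_nhdsGT_iff_subtype {β : Type*} {u : ℝ → β} {l : Filter β} :
    Tendsto u (𝓝[>] 0) l ↔
      Tendsto (fun ε : Set.Ioi (0 : ℝ) => u ε) (comap Subtype.val (𝓝[>] 0)) l := by
  have h : map ((↑) : Set.Ioi (0 : ℝ) → ℝ) (comap (↑) (𝓝[>] (0 : ℝ))) = 𝓝[>] 0 := by
    rw [subtype_coe_map_comap]
    exact inf_eq_left.2 (le_principal_iff.2 self_mem_nhdsWithin)
  conv_lhs => rw [← h]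
  exact tendsto_map'_iff.trans Iff.rfl

/-- Homogenization for a symmetrized kernel `Λ^ε(x,y) ν^ε(x) = k((x,y),(x,y)/ε)` and a periodic
weight `ν^ε(x) = ν(x/ε)`. -/
theorem homogenization_of_kernel {α : ℝ} (hα : 0 < α)
    {Λε : ℝ → Euc d → Euc d → ℝ} {νε : ℝ → Euc d → ℝ} {Λeff : Euc d → Euc d → ℝ}
    {k : Euc d × Euc d → Euc d × Euc d → ℝ} {ν : Euc d → ℝ} {c M : ℝ} (hc : 0 < c)
    (hkc : ∀ q, Continuous fun p => k p q) (hkm : ∀ p, AEMeasurable (k p))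
    (hk₁ : ∀ p η, UnitPeriodic fun ξ => k p (ξ, η)) (hk₂ : ∀ p ξ, UnitPeriodic fun η => k p (ξ, η))
    (hkb : ∀ p q, k p q ∈ Set.Icc c M) (hν : AEMeasurable ν) (hνp : UnitPeriodic ν)
    (hνb : ∀ x, ν x ∈ Set.Icc c M)
    (hΛε : ∀ ε p, Λε ε p.1 p.2 * νε ε p.1 = k p (ε⁻¹ • p))
    (hνε : ∀ ε x, νε ε x = ν (ε⁻¹ • x))
    (hΛeff : ∀ p : Euc d × Euc d, (∫ ξ in unitCell d, ν ξ) * Λeff p.1 p.2 =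
      ∫ q in unitCell d ×ˢ unitCell d, k p q)
    {m : ℝ} (hm : 0 < m) (f : L2 d) :
    (∀ ε : ℝ, 0 < ε → ∃! u : fracSobolev d (α / 2),
      IsResolventSolution α (Λε ε) (νε ε) m f u) ∧
    (∃! u : fracSobolev d (α / 2), IsResolventSolution α Λeff (fun _ => 1) m f u) ∧
    ∀ (u : ℝ → fracSobolev d (α / 2)) (u₀ : fracSobolev d (α / 2)),
      (∀ ε : ℝ, 0 < ε → IsResolventSolution α (Λε ε) (νε ε) m f (u ε)) →
      IsResolventSolution α Λeff (fun _ => 1) m f u₀ →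
      Tendsto u (𝓝[>] 0) (𝓝 u₀) := by
  have habs : ∀ {t : ℝ}, t ∈ Set.Icc c M → |t| ≤ M := fun ht =>
    abs_le.2 ⟨by linarith [ht.1, ht.2], ht.2⟩
  have hkM : ∀ p q, |k p q| ≤ M := fun p q => habs (hkb p q)
  set ν₀ := ∫ ξ in unitCell d, ν ξ with hν₀
  have hν₀b : ν₀ ∈ Set.Icc c M := setIntegral_mem_Icc volume_unitCell hν hνb
  have hν₀0 : ν₀ ≠ 0 := (hc.trans_le hν₀b.1).ne'
  set κ₀ : Euc d × Euc d → ℝ := fun p => ∫ q in unitCell d ×ˢ unitCell d, k p q with hκ₀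
  have hY := isAveragingCell_pair d
  have hκ₀b : ∀ p, κ₀ p ∈ Set.Icc c M := fun p => setIntegral_mem_Icc hY.mass (hkm p) (hkb p)
  have hκ₀m : AEMeasurable κ₀ := aemeasurable_average hkc hkm hkM _
  have hνm : ∀ ε : ℝ, 0 < ε → AEMeasurable fun x => ν (ε⁻¹ • x) := fun ε hε =>
    hν.comp_quasiMeasurePreserving
      (Measure.quasiMeasurePreserving_smul volume (inv_ne_zero hε.ne'))
  have hκm : ∀ ε : ℝ, 0 < ε → AEMeasurable fun p => k p (ε⁻¹ • p) := fun ε hε =>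
    aemeasurable_rescaled hkc hkm hkM hε
  have hsol : ∀ ε : ℝ, 0 < ε → ∀ u : fracSobolev d (α / 2),
      IsResolventSolution α (Λε ε) (νε ε) m f u ↔
        IsWeakSolution (fun p => k p (ε⁻¹ • p)) (fun x => ν (ε⁻¹ • x)) m f u := by
    intro ε hε u
    have e1 : νε ε = fun x => ν (ε⁻¹ • x) := funext (hνε ε)
    have e2 : (fun p => k p (ε⁻¹ • p)) =
        fun p : Euc d × Euc d => Λε ε p.1 p.2 * ν (ε⁻¹ • p.1) := by
      funext p
      rw [← hΛε, hνε]
    rw [e2, e1]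
    exact isResolventSolution_iff (hνm ε hε) (fun x => habs (hνb _))
  have hsol₀ : ∀ u : fracSobolev d (α / 2), IsResolventSolution α Λeff (fun _ => 1) m f u ↔
      IsWeakSolution κ₀ (fun _ => ν₀) m f u := by
    intro u
    rw [isResolventSolution_iff aemeasurable_const (M := 1) (fun x => by simp),
      ← isWeakSolution_const_mul_iff hν₀0]
    simp only [mul_one, hΛeff, hκ₀]
  refine ⟨fun ε hε => ?_, ?_, fun u u₀ hu hu₀ => ?_⟩
  · simp_rw [hsol ε hε]
    exact existsUnique_isWeakSolution (hκm ε hε) (hνm ε hε) hc (fun p => (hkb _ _).1)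
      (fun p => hkM _ _) (fun x => (hνb _).1) (fun x => habs (hνb _)) hm f
  · simp_rw [hsol₀]
    exact existsUnique_isWeakSolution hκ₀m aemeasurable_const hc (fun p => (hκ₀b p).1)
      (fun p => habs (hκ₀b p)) (fun x => hν₀b.1) (fun x => habs hν₀b) hm f
  · rw [tendsto_nhdsGT_iff_subtype]
    refine tendsto_weakSolution (s := α / 2) (by positivity) hc
      (κ := fun ε : Set.Ioi (0 : ℝ) => fun p => k p ((ε : ℝ)⁻¹ • p))
      (w := fun ε : Set.Ioi (0 : ℝ) => fun x => ν ((ε : ℝ)⁻¹ • x))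
      (fun ε => hκm ε ε.2) hκ₀m (fun ε => hνm ε ε.2) aemeasurable_const
      (fun ε p => (hkb _ _).1) (fun ε x => (hνb _).1) (fun ε p => hkM _ _)
      (fun p => habs (hκ₀b p)) (fun ε x => habs (hνb _)) (fun x => habs hν₀b) ?_ ?_ hm
      (fun ε => (hsol ε ε.2 _).1 (hu ε ε.2)) ((hsol₀ _).1 hu₀)
    · intro G hG
      exact tendsto_nhdsGT_iff_subtype.1 (tendsto_integral_locally_periodic hY hkc hkm hkM
        (fun p => periodic_pair (hk₁ p) (hk₂ p)) hG)
    · intro G hG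
      exact tendsto_nhdsGT_iff_subtype.1 (tendsto_integral_periodic (isAveragingCell_unitCell d)
        hν (fun x => habs (hνb x)) hνp.add_basis hG)

/-- The factor `λ(x/ε)` cancels in `Λ^ε ν^ε`, leaving the purely periodic symmetric kernel `μ(ξ)
μ(η)`. Its mean `(∫ μ)²`, divided by the mean of `μ/λ`, is `Λeff`. -/
theorem homogenization_productCase {α : ℝ} (hα : 0 < α) {γ : ℝ} (hγ : 1 < γ)
    {Λε : ℝ → Euc d → Euc d → ℝ} {νε : ℝ → Euc d → ℝ} {Λeff : Euc d → Euc d → ℝ}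
    (hΛ : ProductCase γ Λε νε Λeff) {m : ℝ} (hm : 0 < m) (f : L2 d) :
    (∀ ε : ℝ, 0 < ε → ∃! u : fracSobolev d (α / 2),
      IsResolventSolution α (Λε ε) (νε ε) m f u) ∧
    (∃! u : fracSobolev d (α / 2), IsResolventSolution α Λeff (fun _ => 1) m f u) ∧
    ∀ (u : ℝ → fracSobolev d (α / 2)) (u₀ : fracSobolev d (α / 2)),
      (∀ ε : ℝ, 0 < ε → IsResolventSolution α (Λε ε) (νε ε) m f (u ε)) →
      IsResolventSolution α Λeff (fun _ => 1) m f u₀ →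
      Tendsto u (𝓝[>] 0) (𝓝 u₀) := by
  obtain ⟨lam, mu, hlam, hmu, hlamp, hmup, hlamb, hmub, hΛε, hνε, hΛeff⟩ := hΛ
  have hγ0 : 0 < γ := one_pos.trans hγ
  have hγi : 0 < γ⁻¹ := inv_pos.2 hγ0
  have hlam0 : ∀ x, 0 < lam x := fun x => hγi.trans_le (hlamb x).1
  have hmu0 : ∀ x, 0 < mu x := fun x => hγi.trans_le (hmub x).1
  have hνb : ∀ x, mu x / lam x ∈ Set.Icc (γ⁻¹ * γ⁻¹) (γ * γ) := fun x => by
    rw [div_eq_mul_inv]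
    refine ⟨mul_le_mul (hmub x).1 (inv_anti₀ (hlam0 x) (hlamb x).2) hγi.le (hmu0 x).le,
      mul_le_mul (hmub x).2 ?_ (inv_pos.2 (hlam0 x)).le hγ0.le⟩
    have := inv_anti₀ hγi (hlamb x).1
    rwa [inv_inv] at this
  have hν₀ : 0 < ∫ ξ in unitCell d, mu ξ / lam ξ :=
    (by positivity : 0 < γ⁻¹ * γ⁻¹).trans_le
      (setIntegral_mem_Icc volume_unitCell (hmu.div hlam) hνb).1
  refine homogenization_of_kernel hα (k := fun _ q => mu q.1 * mu q.2)
    (ν := fun x => mu x / lam x) (c := γ⁻¹ * γ⁻¹) (M := γ * γ) (by positivity)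
    (fun q => continuous_const) (fun p => ?_) (fun p η i ξ => ?_) (fun p ξ i η => ?_)
    (fun p q => ?_) (hmu.div hlam) (fun i ξ => ?_) hνb (fun ε p => ?_) hνε (fun p => ?_) hm f
  · exact (hmu.comp_quasiMeasurePreserving Measure.quasiMeasurePreserving_fst).mul
      (hmu.comp_quasiMeasurePreserving Measure.quasiMeasurePreserving_snd)
  · simp only [hmup i ξ]
  · simp only [hmup i η]
  · exact ⟨mul_le_mul (hmub _).1 (hmub _).1 hγi.le (hmu0 _).le,
      mul_le_mul (hmub _).2 (hmub _).2 (hmu0 _).le hγ0.le⟩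
  · simp only [hmup i ξ, hlamp i ξ]
  · rw [hΛε, hνε, Prod.smul_fst, Prod.smul_snd]
    rw [mul_div_assoc', mul_assoc, mul_div_cancel_left₀ _ (hlam0 (ε⁻¹ • p.1)).ne', mul_comm]
  · rw [hΛeff, ← mul_assoc, mul_inv_cancel₀ hν₀.ne', one_mul, pow_two]
    exact (setIntegral_prod_mul mu mu (unitCell d) (unitCell d)).symm

theorem homogenization_locallyPeriodicCase {α : ℝ} (hα : 0 < α) {γ : ℝ} (hγ : 1 < γ)
    {Λε : ℝ → Euc d → Euc d → ℝ} {νε : ℝ → Euc d → ℝ} {Λeff : Euc d → Euc d → ℝ}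
    (hΛ : LocallyPeriodicCase γ Λε νε Λeff) {m : ℝ} (hm : 0 < m) (f : L2 d) :
    (∀ ε : ℝ, 0 < ε → ∃! u : fracSobolev d (α / 2),
      IsResolventSolution α (Λε ε) (νε ε) m f u) ∧
    (∃! u : fracSobolev d (α / 2), IsResolventSolution α Λeff (fun _ => 1) m f u) ∧
    ∀ (u : ℝ → fracSobolev d (α / 2)) (u₀ : fracSobolev d (α / 2)),
      (∀ ε : ℝ, 0 < ε → IsResolventSolution α (Λε ε) (νε ε) m f (u ε)) →
      IsResolventSolution α Λeff (fun _ => 1) m f u₀ →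
      Tendsto u (𝓝[>] 0) (𝓝 u₀) := by
  obtain ⟨Λ, hc, hmeas, hp₁, hp₂, -, hb, hΛε, hνε, hΛeff⟩ := hΛ
  have hγi : 0 < γ⁻¹ := inv_pos.2 (one_pos.trans hγ)
  refine homogenization_of_kernel hα (k := fun p q => Λ p.1 p.2 q.1 q.2) (ν := fun _ => 1)
    (c := γ⁻¹) (M := γ) hγi (fun q => hc _ _) (fun p => hmeas _ _) (fun p η => hp₁ _ _ _)
    (fun p ξ => hp₂ _ _ _) (fun p q => hb _ _ _ _) aemeasurable_const (fun _ _ => rfl)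
    (fun x => ⟨inv_le_one_of_one_le₀ hγ.le, hγ.le⟩) (fun ε p => ?_) hνε (fun p => ?_) hm f
  · rw [hΛε, hνε, mul_one, Prod.smul_fst, Prod.smul_snd]
  · have hfin : IsFiniteMeasure ((volume : Measure (Euc d)).restrict (unitCell d)) :=
      ⟨by simp [volume_unitCell]⟩
    have hint : Integrable (fun q : Euc d × Euc d => Λ p.1 p.2 q.1 q.2)
        (((volume : Measure (Euc d)).restrict (unitCell d)).prod
          ((volume : Measure (Euc d)).restrict (unitCell d))) := by
      refine Integrable.of_mem_Icc γ⁻¹ γ ?_ (Eventually.of_forall fun q => hb _ _ _ _)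
      rw [Measure.prod_restrict]
      exact (hmeas p.1 p.2).restrict
    have hone : ∫ _ in unitCell d, (1 : ℝ) = 1 := by simp [measureReal_def, volume_unitCell]
    rw [hΛeff, hone, one_mul, Measure.volume_eq_prod, ← Measure.prod_restrict, integral_prod_symm _ hint]

end LevyHomogenization

end

open LevyHomogenization
theorem theorem1p1 (d : ℕ) (hd : 0 < d) (α : ℝ) (hα : α ∈ Set.Ioo (0 : ℝ) 2)
    (γ : ℝ) (hγ : 1 < γ)
    (Λε : ℝ → Euc d → Euc d → ℝ) (νε : ℝ → Euc d → ℝ) (Λeff : Euc d → Euc d → ℝ)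
    (hΛ : ProductCase γ Λε νε Λeff ∨ LocallyPeriodicCase γ Λε νε Λeff)
    (m : ℝ) (hm : 0 < m) (f : L2 d) :
    (∀ ε : ℝ, 0 < ε → ∃! u : fracSobolev d (α / 2),
      IsResolventSolution α (Λε ε) (νε ε) m f u) ∧
    (∃! u : fracSobolev d (α / 2), IsResolventSolution α Λeff (fun _ => 1) m f u) ∧
    ∀ (u : ℝ → fracSobolev d (α / 2)) (u₀ : fracSobolev d (α / 2)),
      (∀ ε : ℝ, 0 < ε → IsResolventSolution α (Λε ε) (νε ε) m f (u ε)) →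
      IsResolventSolution α Λeff (fun _ => 1) m f u₀ →
      Tendsto (fun ε => toL2 (u ε)) (𝓝[>] 0) (𝓝 (toL2 u₀)) ∧
      Tendsto (fun ε => toWeakSpace ℝ (fracSobolev d (α / 2)) (u ε)) (𝓝[>] 0)
        (𝓝 (toWeakSpace ℝ (fracSobolev d (α / 2)) u₀)) := by
  obtain ⟨h₁, h₂, h₃⟩ := hΛ.elim (fun h => homogenization_productCase hα.1 hγ h hm f)
    (fun h => homogenization_locallyPeriodicCase hα.1 hγ h hm f)
  refine ⟨h₁, h₂, fun u u₀ hu hu₀ => ?_⟩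
  -- This is norm convergence in `H^{α/2}`; the inclusion into `L²` and the identity into the weak
  -- topology are continuous.
  have hlim := h₃ u u₀ hu hu₀
  exact ⟨((toL2CLM (d := d) (s := α / 2)).continuous.tendsto u₀).comp hlim,
    ((toWeakSpaceCLM ℝ (fracSobolev d (α / 2))).continuous.tendsto u₀).comp hlim⟩
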